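/- **Setting.** Let $\mathcal Z\subseteq\mathbb R^d$, let $[d]=R\sqcup U$ (invariant features $R$, spurious features $U$), let $\mathcal D_z$ be a probability distribution on $\mathcal Z$ under which $z_R$ and $z_U$ are independent, and let $g:\mathcal Z\to\mathcal X$ be a generative function. Draw $z=[z_R;z_U]\sim\mathcal D_z$, an independent copy $z_U^+$ of $z_U$ and an independent copy $z^-$ of $z$; put $z^+=[z_R;z_U^+]$, $x=g(z)$, $x^+=g(z^+)$, $x^-=g(z^-)$. Assume * (A1) $z_R$ can be recovered from $x$: if $z,z'\in\mathcal Z$ and $g(z)=g(z')$ then $z_R=z'_R$; * (A2) the representations are the functions $\phi:\mathcal X\to\mathbb R^k$ with $\|\phi(x)\|=B_r$ for all $x$ ($B_r>0$) that are regular: $\mathcal Z$ has a partition into finitely many subsets on each of which $\phi\circ g$ is $L$-Lipschitz, for some finite $L$ (and $\phi\circ g$ is measurable). The output dimension $k$ ranges over a given set $K\subseteq\mathbb N$ ($K=\{k\}$: fixed dimension; $K=\mathbb N$: free dimension); * (A3) the loss $\ell:\mathbb R\to\mathbb R$ is convex, strictly decreasing and bounded below. An optimal representation $\phi^*$ is any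 minimizer of $\mathbb E[\ell(\phi(x)^\top(\phi(x^+)-\phi(x^-)))]$ over these representations. A function $f(z)$ is independent of $z_S$ if $f(z)=f'(z_{-S})$ almost surely for some function $f'$ of the coordinates outside $S$. A representation $\phi$ encodes $z_i$ if $\phi\circ g$ is not independent of $z_i$ whenever $g$ is not independent of $z_i$. For $i\in R$ put $p_i=\Pr[z_{R\setminus\{i\}}=z^-_{R\setminus\{i\}},\ z_i\ne z_i^-]$. **Theorem.** Assume (A1), (A2), (A3). 1. If $z_R$ is not almost surely constant, then for every $K$ and every $B_r>0$, $\phi^*\circ g(z)$ is independent of $z_U$ for every optimal representation $\phi^*$. 2. Let $K$ be unbounded. For every $i\in R$ there is $B_i>0$ such that whenever $B_r\ge B_i$, every optimal representation encodes $z_i$. 3. In the discrete case, $B_i$ can be taken to be a decreasing function of $p_i$: * If $K$ is unbounded and $z_R$ is discrete (takes values in a countable set almost surely), one can take $B_i=\beta(p_i)$ when $p_i>0$, with a strictly decreasing function $\beta:(0,1]\to(0,\infty)$ that depends only on $\ell$. * If $\mathcal Z$ is finite, or more generally if $z_R$ takes at most $n$ values on $\mathcal Z$, the same holds for every $K$ that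 contains some $k\ge 2$ (in particular for a fixed output dimension $k\ge2$), with a strictly decreasing $\beta:(0,1]\to(0,\infty)$ that depends only on $\ell$ and $n$. In both cases, if $p_i=0$, then every $B_r>0$ is large enough. -/

import Mathlib

open MeasureTheory ProbabilityTheory

universe u

/-- Euclidean space of dimension `n`. -/
abbrev Euc (n : ℕ) : Type := EuclideanSpace ℝ (Fin n)

/-- The coordinates `z_S` of a vector `z`, for a set `S` of indices. -/
def coords {d : ℕ} (S : Finset (Fin d)) (z : Euc d) : S → ℝ := fun j => z j

/-- `[z_R ; w_U]` with `U` the complement of `R`: the vector with the coordinates of `z` on `R`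
and those of `w` off `R`. -/
noncomputable def glue {d : ℕ} (R : Finset (Fin d)) (z w : Euc d) : Euc d :=
  WithLp.toLp 2 (fun j => if j ∈ R then z j else w j)

/-- `f` is independent of the input coordinates `z_S`: with probability one `f z` is a function
of the remaining coordinates `z_{-S}` only. -/
def IndependentOf {d : ℕ} {Y : Type*} (D : Measure (Euc d)) (S : Finset (Fin d))
    (f : Euc d → Y) : Prop :=
  ∃ f' : ((Sᶜ : Finset (Fin d)) → ℝ) → Y, ∀ᵐ z ∂D, f z = f' (coords Sᶜ z)

/-- The hidden representation data model. A hidden vector `z = [z_R ; z_U]` is drawn from a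
probability distribution `D` on the hidden space `Z ⊆ ℝ^d`; its invariant part `z_R` and its
spurious part `z_U` (`U` is the complement of `R`) are independent; the input is `x = g z`.
The values of `g` off `Z` play no role. -/
structure DataModel (d : ℕ) (X : Type u) where
  /-- the hidden representation space -/
  Z : Set (Euc d)
  /-- the invariant features -/
  R : Finset (Fin d)
  /-- the distribution of `z` -/
  D : Measure (Euc d)
  isProb : IsProbabilityMeasure D
  mem_Z : ∀ᵐ z ∂D, z ∈ Z
  indep : IndepFun (coords R) (coords Rᶜ) D
  /-- the generative function -/
  g : Euc d → X

namespace DataModel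

variable {d : ℕ} {X : Type u} (M : DataModel d X)

/-- (A1): `z_R` can be recovered from `x = g z`. -/
def Recoverable : Prop :=
  ∀ z ∈ M.Z, ∀ z' ∈ M.Z, M.g z = M.g z' → coords M.R z = coords M.R z'

/-- The invariant part `z_R` is almost surely constant (as it is when `R` is empty). -/
def InvariantPartConstant : Prop :=
  ∃ c : M.R → ℝ, ∀ᵐ z ∂M.D, coords M.R z = c

/-- `φ` is regular: `Z` splits into finitely many parts (the colour classes of `c`) such that
`φ ∘ g` is `L`-Lipschitz on each of them, for some finite `L`. -/
def IsRegular {k : ℕ} (φ : X → Euc k) : Prop :=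
  ∃ (L : NNReal) (n : ℕ) (c : Euc d → Fin n),
    ∀ j, LipschitzOnWith L (fun z => φ (M.g z)) {z | z ∈ M.Z ∧ c z = j}

/-- (A2): the representations with values in `ℝ^k`, i.e. the regular functions of constant norm
`B`. Measurability of `φ ∘ g` is what the expected loss needs to make sense. -/
structure IsRepresentation (B : ℝ) {k : ℕ} (φ : X → Euc k) : Prop where
  norm_eq : ∀ x, ‖φ x‖ = B
  regular : M.IsRegular φ
  measurable : AEStronglyMeasurable (fun z => φ (M.g z)) M.D

/-- The expected contrastive loss `E [ℓ (φ(x)ᵀ (φ(x⁺) - φ(x⁻)))]`. Here `t = (z, w, z⁻)` are three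
independent draws from `D`, and `z⁺ = [z_R ; w_U]`, so that `z⁺_U` is an independent draw from
the distribution of `z_U`. -/
noncomputable def contrastiveLoss (ℓ : ℝ → ℝ) {k : ℕ} (φ : X → Euc k) : ℝ :=
  ∫ t : Euc d × Euc d × Euc d,
    ℓ (inner ℝ (φ (M.g t.1)) (φ (M.g (glue M.R t.1 t.2.1)) - φ (M.g t.2.2)))
    ∂(M.D.prod (M.D.prod M.D))

/-- `φ` is an optimal representation: it minimizes the expected contrastive loss among the
representations of norm `B` whose output dimension belongs to `K`. `K = {k}` is the case of a
fixed output dimension; `K = Set.univ` leaves it free. -/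
def IsOptimal (ℓ : ℝ → ℝ) (K : Set ℕ) (B : ℝ) {k : ℕ} (φ : X → Euc k) : Prop :=
  k ∈ K ∧ M.IsRepresentation B φ ∧
    ∀ k' ∈ K, ∀ ψ : X → Euc k', M.IsRepresentation B ψ →
      M.contrastiveLoss ℓ φ ≤ M.contrastiveLoss ℓ ψ

/-- `φ` encodes the feature `z_i`: `φ ∘ g` is not independent of `z_i` as long as `g` is not. -/
def Encodes {k : ℕ} (φ : X → Euc k) (i : Fin d) : Prop :=
  ¬ IndependentOf M.D {i} M.g → ¬ IndependentOf M.D {i} (fun z => φ (M.g z))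

/-- `Pr [z_{R∖i} = z⁻_{R∖i}, z_i ≠ z⁻_i]` for independent draws `z, z⁻` from `D`. -/
noncomputable def spread (i : Fin d) : ℝ :=
  (M.D.prod M.D).real {q | (∀ j ∈ M.R, j ≠ i → q.1 j = q.2 j) ∧ q.1 i ≠ q.2 i}

end DataModel

/-! Spurious features. The loss of `φ ∘ g` is an average over pairs `(r, r')` of invariant values.
Aligning `z` with `z⁺` raises the argument of `ℓ`, and when `r = r'` Jensen's inequality bounds the
average below by `ℓ 0`. Cut the space of invariant values into finitely many cells, draw one
spurious value per cell independently, and insert it. The resulting function of `z_R` does no worse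
on average, apart from distinct pairs in one cell, which fine cells make rare; it does strictly
better if `φ ∘ g` depends on `z_U`. Finitely many cells keep it regular. This is
`exists_section_integral_lt`; hence an optimum is a function `ψ` of `z_R`
(`IsOptimal.exists_isInvRepresentation`).

Invariant features. With unbounded dimension, vectors of norm at most `B` can be completed to norm
`B` by orthogonal directions, one per cell, without changing inner products across cells. So `ψ`
competes with a relaxed problem in which equal points cost `ℓ 0` and the vectors may be short
(`IsOptimal.invLoss_le_relaxedLoss`). The zero vector gives loss `ℓ (B ^ 2)` off the diagonal. If
`z_i` is not encoded, pairs differing only at `i` still cost `ℓ 0`, so `p_i * (ℓ 0 - inf ℓ) ≤ ℓ (B ^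
2) - inf ℓ`, which fails for large `B`. In bounded dimension, `n` separated points on a circle
replace the orthogonal directions. If `p_i = 0` and `z_R` is discrete, `z_i` is a function of the
other coordinates and nothing has to be encoded.

If the law of `z_R` has a nonatomic part, no optimum exists for large `B` (`not_relaxed_optimal`):
replacing `ψ` there by its mean forces equality in Jensen's inequality, so `ℓ` meets a tangent line
both at `0` and at the point of tangency; this bounds the latter, and comparison with the zero
vector gives a contradiction. -/

/-! ### Convex functions and integrals -/

theorem ConvexOn.exists_forall_add_mul_le {f : ℝ → ℝ} (hf : ConvexOn ℝ Set.univ f) (y : ℝ) :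
    ∃ s : ℝ, ∀ x, f y + s * (x - y) ≤ f x := by
  have hy : y ∈ interior (Set.univ : Set ℝ) := by simp
  refine ⟨derivWithin f (Set.Ioi y) y, fun x => ?_⟩
  rcases lt_trichotomy x y with h | rfl | h
  · have h1 := hf.slope_le_leftDeriv_of_mem_interior (Set.mem_univ x) hy h
    have h2 := hf.leftDeriv_le_rightDeriv_of_mem_interior hy
    have h3 := h1.trans h2
    rw [slope_def_field, div_le_iff₀ (by linarith)] at h3
    linarith
  · simp
  · have h1 := hf.rightDeriv_le_slope_of_mem_interior hy (Set.mem_univ x) h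
    rw [slope_def_field, le_div_iff₀ (by linarith)] at h1
    linarith

theorem ConvexOn.continuous_of_univ {f : ℝ → ℝ} (hf : ConvexOn ℝ Set.univ f) : Continuous f :=
  hf.locallyLipschitz.continuous

theorem Continuous.exists_norm_le_of_abs_le {f : ℝ → ℝ} (hf : Continuous f) (b : ℝ) :
    ∃ C : ℝ, ∀ x, |x| ≤ b → ‖f x‖ ≤ C := by
  obtain ⟨C, hC⟩ := (isCompact_Icc (a := -b) (b := b)).exists_bound_of_continuousOn hf.continuousOn
  exact ⟨C, fun x hx => hC x (abs_le.mp hx)⟩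

theorem MeasureTheory.MeasurePreserving.integral_comp_of_aestronglyMeasurable
    {α β : Type*} [MeasurableSpace α] [MeasurableSpace β] {μ : Measure α} {ν : Measure β}
    {g : α → β} (hg : MeasurePreserving g μ ν) {f : β → ℝ} (hf : AEStronglyMeasurable f ν) :
    ∫ x, f (g x) ∂μ = ∫ y, f y ∂ν := by
  rw [← hg.map_eq] at hf ⊢
  exact (integral_map hg.aemeasurable hf).symm

theorem Measurable.integrable_of_norm_le {α : Type*} [MeasurableSpace α] {μ : Measure α}
    [IsFiniteMeasure μ] {f : α → ℝ} (hf : Measurable f) {C : ℝ} (h : ∀ x, ‖f x‖ ≤ C) :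
    Integrable f μ :=
  Integrable.of_bound hf.aestronglyMeasurable C (ae_of_all _ h)

/-! ### Finite partitions separating most pairs -/

section Cells

variable {A : Type*} [MeasurableSpace A] [MeasurableSpace.CountablyGenerated A]
  [MeasurableSpace.SeparatesPoints A] [MeasurableEq A]

/-- A countably generated space has finite measurable partitions such that two independent
points rarely lie in one cell without being equal. -/
theorem exists_measurable_cells (μ : Measure (A × A)) [IsFiniteMeasure μ] {ε : ℝ} (hε : 0 < ε) :
    ∃ (n : ℕ) (c : A → Fin n → Bool), Measurable c ∧
      μ.real {q | c q.1 = c q.2 ∧ q.1 ≠ q.2} < ε := by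
  -- The first `n` bits of an injective coding by binary sequences. The sets of unseparated distinct
  -- pairs decrease to the empty set, so continuity from above applies.
  let c : ∀ n : ℕ, A → Fin n → Bool := fun n a i => MeasurableSpace.mapNatBool A a i
  have hc : ∀ n, Measurable (c n) := fun n => measurable_pi_lambda _ fun i =>
    (measurable_pi_apply _).comp (MeasurableSpace.measurable_mapNatBool A)
  let s : ℕ → Set (A × A) := fun n => {q | c n q.1 = c n q.2 ∧ q.1 ≠ q.2}
  have hdiag : MeasurableSet {q : A × A | q.1 ≠ q.2} :=
    (measurableSet_diagonal : MeasurableSet (Set.diagonal A)).compl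
  have hs : ∀ n, MeasurableSet (s n) := fun n =>
    (measurableSet_eq_fun ((hc n).comp measurable_fst) ((hc n).comp measurable_snd)).inter hdiag
  have hanti : Antitone s := by
    intro n k hnk q hq
    refine ⟨funext fun i => ?_, hq.2⟩
    exact congrFun hq.1 ⟨i, i.2.trans_le hnk⟩
  have hempty : ⋂ n, s n = ∅ := by
    refine Set.eq_empty_of_forall_notMem fun q hq => ?_
    rw [Set.mem_iInter] at hq
    refine (hq 0).2 (MeasurableSpace.injective_mapNatBool A (funext fun i => ?_))
    exact congrFun (hq (i + 1)).1 ⟨i, Nat.lt_succ_self i⟩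
  have ht := tendsto_measure_iInter_atTop (μ := μ) (fun n => (hs n).nullMeasurableSet) hanti
    ⟨0, measure_ne_top _ _⟩
  rw [hempty, measure_empty] at ht
  have ht' := (ENNReal.tendsto_toReal ENNReal.zero_ne_top).comp ht
  obtain ⟨n, hn⟩ := (ht'.eventually_lt_const (show (0 : ENNReal).toReal < ε by simpa)).exists
  exact ⟨n, c n, hc n, hn⟩

end Cells

/-! ### Random sections of the spurious part -/

/-- Distinct coordinates of a product measure are independent. Spurious values drawn for two
different cells thus behave like two independent draws. -/
theorem measurePreserving_eval_pair {ι W : Type*} [Fintype ι] [MeasurableSpace W] (ν : Measure W)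
    [IsProbabilityMeasure ν] {a b : ι} (hab : a ≠ b) :
    MeasurePreserving (fun u : ι → W => (u a, u b)) (Measure.pi fun _ => ν) (ν.prod ν) := by
  refine ⟨(measurable_pi_apply a).prodMk (measurable_pi_apply b), ?_⟩
  have h := (iIndepFun_pi (μ := fun _ : ι => ν) (X := fun _ => (id : W → W))
    fun _ => aemeasurable_id).indepFun hab
  have h2 := h.map_prod_eq_prod_map_map (measurable_pi_apply a).aemeasurable
    (measurable_pi_apply b).aemeasurable
  refine h2.trans ?_
  rw [ (measurePreserving_eval (fun _ : ι => ν) a).map_eq,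
    (measurePreserving_eval (fun _ : ι => ν) b).map_eq]

section Sections

variable {A W E : Type*} [MeasurableSpace A] [MeasurableSpace W]
  [NormedAddCommGroup E] [InnerProductSpace ℝ E]

/-- Fubini: the integrand ignores the invariant part of the second draw, which integrates out. What
remains is an average over pairs of invariant values of an average over three spurious ones. -/
theorem integral_prod_prod_prod (μ : Measure A) (ν : Measure W)
    [IsProbabilityMeasure μ] [IsProbabilityMeasure ν]
    {f : (A × A) × W × W × W → ℝ} (hf : Measurable f) {C : ℝ} (hC : ∀ x, ‖f x‖ ≤ C) :
    ∫ t : (A × W) × (A × W) × (A × W), f ((t.1.1, t.2.2.1), t.1.2, t.2.1.2, t.2.2.2)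
        ∂((μ.prod ν).prod ((μ.prod ν).prod (μ.prod ν))) =
      ∫ q, ∫ s, f (q, s) ∂(ν.prod (ν.prod ν)) ∂(μ.prod μ) := by
  have int : ∀ {α : Type _} [MeasurableSpace α] (τ : Measure α) [IsFiniteMeasure τ]
      (k : α → (A × A) × W × W × W), Measurable k → Integrable (fun x => f (k x)) τ :=
    fun τ _ k hk => (hf.comp hk).integrable_of_norm_le fun _ => hC _
  have int2 : ∀ (r : A) (u : W), Integrable (fun p : W × A => ∫ v, f ((r, p.2), u, p.1, v) ∂ν)
      (ν.prod μ) := by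
    intro r u
    exact (int ((ν.prod μ).prod ν) (fun p => ((r, p.1.2), u, p.1.1, p.2)) (by fun_prop)).integral_prod_left
  have int3 : ∀ r : A, Integrable (fun p : W × A => ∫ s : W × W, f ((r, p.2), p.1, s) ∂(ν.prod ν))
      (ν.prod μ) := by
    intro r
    exact (int ((ν.prod μ).prod (ν.prod ν)) (fun p => ((r, p.1.2), p.1.1, p.2)) (by fun_prop)).integral_prod_left
  have i1 : Integrable (fun t : (A × W) × (A × W) × (A × W) =>
      f ((t.1.1, t.2.2.1), t.1.2, t.2.1.2, t.2.2.2))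
      ((μ.prod ν).prod ((μ.prod ν).prod (μ.prod ν))) := int _ _ (by fun_prop)
  rw [integral_prod _ i1, integral_prod _ i1.integral_prod_left]
  have i2 : Integrable f ((μ.prod μ).prod (ν.prod (ν.prod ν))) := int _ _ measurable_id
  rw [integral_prod _ i2.integral_prod_left]
  refine integral_congr_ae (ae_of_all _ fun r => ?_)
  simp only []
  have key : ∀ u, ∫ y : (A × W) × (A × W), f ((r, y.2.1), u, y.1.2, y.2.2)
      ∂((μ.prod ν).prod (μ.prod ν)) = ∫ r', ∫ s : W × W, f ((r, r'), u, s) ∂(ν.prod ν) ∂μ := by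
    intro u
    rw [integral_prod _ (int ((μ.prod ν).prod (μ.prod ν)) (fun y => ((r, y.2.1), u, y.1.2, y.2.2)) (by fun_prop))]
    have h1 := integral_fun_snd (μ := μ) (ν := ν)
      (fun u' => ∫ y : A × W, f ((r, y.1), u, u', y.2) ∂(μ.prod ν))
    simp only [probReal_univ, one_smul] at h1
    rw [h1]
    have h2 : ∀ u', ∫ y : A × W, f ((r, y.1), u, u', y.2) ∂(μ.prod ν) =
        ∫ r', ∫ v, f ((r, r'), u, u', v) ∂ν ∂μ := fun u' =>
      integral_prod _ (int (μ.prod ν) (fun y => ((r, y.1), u, u', y.2)) (by fun_prop))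
    simp only [h2]
    rw [integral_integral_swap (int2 r u)]
    refine integral_congr_ae (ae_of_all _ fun r' => ?_)
    exact (integral_prod _ (Measurable.integrable_of_norm_le (f := fun y => f ((r, r'), u, y))
      (hf.comp (by fun_prop)) fun _ => hC _)).symm
  simp only [key]
  rw [integral_integral_swap (int3 r)]
  refine integral_congr_ae (ae_of_all _ fun r' => ?_)
  exact (integral_prod _ (Measurable.integrable_of_norm_le (f := fun y => f ((r, r'), y))
    (hf.comp (by fun_prop)) fun _ => hC _)).symm

end Sections

section Sections

variable {A W E : Type*} [MeasurableSpace A] [MeasurableSpace W]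
  [NormedAddCommGroup E] [InnerProductSpace ℝ E]

theorem abs_inner_le_of_norm_eq {B : ℝ} {x y : E} (hx : ‖x‖ = B) (hy : ‖y‖ = B) :
    |inner ℝ x y| ≤ B ^ 2 := by
  have := abs_real_inner_le_norm x y
  rwa [hx, hy, ← sq] at this

theorem inner_self_of_norm_eq {B : ℝ} {x : E} (hx : ‖x‖ = B) : inner ℝ x x = B ^ 2 := by
  rw [real_inner_self_eq_norm_sq, hx]

/-- The equality case of Cauchy–Schwarz on a sphere, read off from `‖x - y‖ ^ 2`. -/
theorem eq_of_inner_eq_of_norm_eq {B : ℝ} {x y : E} (hx : ‖x‖ = B) (hy : ‖y‖ = B)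
    (h : inner ℝ x y = B ^ 2) : x = y := by
  have := norm_sub_sq_real x y
  rw [hx, hy, h] at this
  have h0 : ‖x - y‖ = 0 := by nlinarith [norm_nonneg (x - y)]
  exact sub_eq_zero.mp (norm_eq_zero.mp h0)

variable [MeasurableSpace.CountablyGenerated A] [MeasurableSpace.SeparatesPoints A]
  [MeasurableEq A] [MeasurableSpace E] [BorelSpace E] [SecondCountableTopology E]

/-- If `H (r, u)` depends on `u`, then some section `r ↦ H (r, u (c r))`, with `u` taking finitely
many values outside a given null set, has a smaller expected contrastive loss. -/
theorem exists_section_integral_lt {ℓ : ℝ → ℝ} (hconv : ConvexOn ℝ Set.univ ℓ)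
    (hdec : StrictAnti ℓ) {m : ℝ} (hm : ∀ x, m ≤ ℓ x) (μ : Measure A) (ν : Measure W)
    [IsProbabilityMeasure μ] [IsProbabilityMeasure ν] {H : A × W → E} (hH : Measurable H)
    {B : ℝ} (hB : ∀ p, ‖H p‖ = B) (hμ : ∀ a, μ {a} ≠ 1)
    (hne : ¬ ∀ᵐ r ∂μ, ∀ᵐ w ∂(ν.prod ν), H (r, w.1) = H (r, w.2)) {N : Set W} (hN : ν N = 0) :
    ∃ (n : ℕ) (c : A → Fin n → Bool) (u : (Fin n → Bool) → W), Measurable c ∧ (∀ a, u a ∉ N) ∧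
      ∫ q, ℓ (B ^ 2 - inner ℝ (H (q.1, u (c q.1))) (H (q.2, u (c q.2)))) ∂(μ.prod μ) <
      ∫ t : (A × W) × (A × W) × (A × W), ℓ (inner ℝ (H t.1) (H (t.1.1, t.2.1.2) - H t.2.2))
        ∂((μ.prod ν).prod ((μ.prod ν).prod (μ.prod ν))) := by
  have hcont := hconv.continuous_of_univ
  obtain ⟨C, hC⟩ := hcont.exists_norm_le_of_abs_le (2 * B ^ 2)
  have hℓ := hcont.measurable
  -- `f` is the actual loss, `g` the loss if `z` and `z⁺` had the same image. Equality of the two at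
  -- a point forces these images to coincide.
  let f : (A × A) × W × W × W → ℝ := fun p =>
    ℓ (inner ℝ (H (p.1.1, p.2.1)) (H (p.1.1, p.2.2.1) - H (p.1.2, p.2.2.2)))
  let g : (A × A) × W × W × W → ℝ := fun p =>
    ℓ (B ^ 2 - inner ℝ (H (p.1.1, p.2.1)) (H (p.1.2, p.2.2.2)))
  have hf : Measurable f := hℓ.comp (Measurable.inner (by fun_prop) (by fun_prop))
  have hg : Measurable g :=
    hℓ.comp (measurable_const.sub (Measurable.inner (by fun_prop) (by fun_prop)))
  have hfC : ∀ p, ‖f p‖ ≤ C := fun p => hC _ <| by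
    rw [inner_sub_right, abs_le]
    have h1 := abs_le.mp (abs_inner_le_of_norm_eq (hB (p.1.1, p.2.1)) (hB (p.1.1, p.2.2.1)))
    have h2 := abs_le.mp (abs_inner_le_of_norm_eq (hB (p.1.1, p.2.1)) (hB (p.1.2, p.2.2.2)))
    constructor <;> linarith
  have harg : ∀ x y, |B ^ 2 - inner ℝ (H x) (H y)| ≤ 2 * B ^ 2 ∧ 0 ≤ B ^ 2 - inner ℝ (H x) (H y) := by
    intro x y
    have h2 := abs_le.mp (abs_inner_le_of_norm_eq (hB x) (hB y))
    exact ⟨abs_le.mpr ⟨by linarith, by linarith⟩, by linarith⟩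
  have hgC : ∀ p, ‖g p‖ ≤ C := fun p => hC _ (harg _ _).1
  have hgf : ∀ p, g p ≤ f p := fun p => hdec.antitone <| by
    rw [inner_sub_right]
    have h1 := abs_le.mp (abs_inner_le_of_norm_eq (hB (p.1.1, p.2.1)) (hB (p.1.1, p.2.2.1)))
    linarith
  have hgf' : ∀ p, g p = f p → H (p.1.1, p.2.1) = H (p.1.1, p.2.2.1) := fun p hp => by
    have h1 := hdec.injective hp
    rw [inner_sub_right] at h1
    exact eq_of_inner_eq_of_norm_eq (hB _) (hB _) (by linarith)
  let ν3 := ν.prod (ν.prod ν)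
  have hfi : Integrable f ((μ.prod μ).prod ν3) := hf.integrable_of_norm_le hfC
  have hgi : Integrable g ((μ.prod μ).prod ν3) := hg.integrable_of_norm_le hgC
  have hfs : ∀ q, Integrable (fun s => f (q, s)) ν3 := fun q =>
    (hf.comp (by fun_prop)).integrable_of_norm_le fun _ => hfC _
  have hgs : ∀ q, Integrable (fun s => g (q, s)) ν3 := fun q =>
    (hg.comp (by fun_prop)).integrable_of_norm_le fun _ => hgC _
  let Q : A × A → ℝ := fun q => ∫ s, f (q, s) ∂ν3
  let G : A × A → ℝ := fun q => ∫ s, g (q, s) ∂ν3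
  have hQi : Integrable Q (μ.prod μ) := hfi.integral_prod_left
  have hGi : Integrable G (μ.prod μ) := hgi.integral_prod_left
  have hGQ : ∀ q, G q ≤ Q q := fun q => integral_mono (hgs q) (hfs q) fun s => hgf _
  have hmG : ∀ q, m ≤ G q := fun q => by
    have := integral_mono (μ := ν3) (integrable_const m) (hgs q) fun s => hm _
    simpa using this
  -- For equal invariant values, exchanging the last two spurious draws flips the sign of the
  -- argument. Its mean is therefore zero, and the supporting line of `ℓ` at `0` gives the bound.
  have hdiagQ : ∀ r, ℓ 0 ≤ Q (r, r) := by
    intro r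
    obtain ⟨s, hs⟩ := hconv.exists_forall_add_mul_le 0
    let k : W × W × W → ℝ := fun p => inner ℝ (H (r, p.1)) (H (r, p.2.1) - H (r, p.2.2))
    have hk : Measurable k := Measurable.inner (by fun_prop) (by fun_prop)
    have hkb : ∀ p, ‖k p‖ ≤ 2 * B ^ 2 := fun p => by
      have h1 := abs_le.mp (abs_inner_le_of_norm_eq (hB (r, p.1)) (hB (r, p.2.1)))
      have h2 := abs_le.mp (abs_inner_le_of_norm_eq (hB (r, p.1)) (hB (r, p.2.2)))
      simp only [k, inner_sub_right, Real.norm_eq_abs]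
      exact abs_le.mpr ⟨by linarith, by linarith⟩
    have hki : Integrable k ν3 := hk.integrable_of_norm_le hkb
    have hk0 : ∫ p, k p ∂ν3 = 0 := by
      have hmp : MeasurePreserving (Prod.map id Prod.swap : W × W × W → W × W × W) ν3 ν3 :=
        (MeasurePreserving.id ν).prod Measure.measurePreserving_swap
      have h1 := hmp.integral_comp_of_aestronglyMeasurable hk.aestronglyMeasurable
      have h2 : ∀ p, k (Prod.map id Prod.swap p) = - k p := fun p => by
        simp only [k, Prod.map_fst, Prod.map_snd, Prod.fst_swap, Prod.snd_swap, id, inner_sub_right]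
        ring
      simp only [h2, integral_neg] at h1
      linarith
    have h3 := integral_mono (μ := ν3) ((integrable_const (ℓ 0)).add (hki.const_mul s))
      (hfs (r, r)) fun p => by
        have := hs (k p)
        simpa using this
    simp only [Pi.add_apply] at h3
    rw [integral_add (integrable_const _) (hki.const_mul s), integral_const_mul, hk0] at h3
    simpa using h3
  let off : Set (A × A) := {q | q.1 ≠ q.2}
  have hoff : MeasurableSet off :=
    (measurableSet_diagonal : MeasurableSet (Set.diagonal A)).compl
  have hQG : Integrable (off.indicator fun q => Q q - G q) (μ.prod μ) :=
    (hQi.sub hGi).indicator hoff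
  have hQG0 : ∀ q, 0 ≤ off.indicator (fun q => Q q - G q) q := fun q =>
    Set.indicator_nonneg (fun q _ => sub_nonneg.mpr (hGQ q)) q
  -- If the gap vanished, almost every `r` would have some `r' ≠ r` with equal averages, because no
  -- single point carries full mass. Then `f = g` almost everywhere for that pair, and `H (r, ·)`
  -- would be almost surely constant.
  have hgap : 0 < ∫ q, off.indicator (fun q => Q q - G q) q ∂(μ.prod μ) := by
    refine lt_of_le_of_ne (integral_nonneg hQG0) fun h => hne ?_
    have h1 := (integral_eq_zero_iff_of_nonneg hQG0 hQG).mp h.symm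
    have h2 := Measure.ae_ae_of_ae_prod h1
    filter_upwards [h2] with r hr
    have h3 : ∃ r', r' ≠ r ∧ off.indicator (fun q => Q q - G q) (r, r') = 0 := by
      by_contra! hcon
      refine hμ r ((prob_compl_eq_zero_iff₀ (MeasurableSet.singleton r).nullMeasurableSet).mp ?_)
      refine measure_mono_null (fun r' hr' => ?_) hr
      exact hcon r' hr'
    obtain ⟨r', hne', hr'⟩ := h3
    rw [Set.indicator_of_mem (show (r, r') ∈ off from hne'.symm)] at hr'
    have h4 : ∫ s, (f ((r, r'), s) - g ((r, r'), s)) ∂ν3 = 0 := by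
      rw [integral_sub (hfs _) (hgs _)]; exact hr'
    have h5 := (integral_eq_zero_iff_of_nonneg (fun s => sub_nonneg.mpr (hgf ((r, r'), s)))
      ((hfs _).sub (hgs _))).mp h4
    have h6 : ∀ᵐ s ∂ν3, H (r, s.1) = H (r, s.2.1) := h5.mono fun s hs =>
      hgf' ((r, r'), s) (sub_eq_zero.mp hs).symm
    have hmp : MeasurePreserving (Prod.map id Prod.fst : W × W × W → W × W) ν3 (ν.prod ν) :=
      (MeasurePreserving.id ν).prod measurePreserving_fst
    have hms : MeasurableSet {w : W × W | H (r, w.1) = H (r, w.2)} :=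
      measurableSet_eq_fun (by fun_prop) (by fun_prop)
    rw [← hmp.map_eq, ae_map_iff hmp.aemeasurable hms]
    exact h6
  -- A distinct pair in one cell costs at most `ℓ 0 - m` extra, so this error stays below the gap;
  -- the `+ 1` keeps the denominator positive.
  obtain ⟨n, c, hc, hcε⟩ := exists_measurable_cells (μ.prod μ)
    (show 0 < (∫ q, off.indicator (fun q => Q q - G q) q ∂(μ.prod μ)) / (ℓ 0 - m + 1) from
      div_pos hgap (by linarith [hm 0]))
  let S : Set (A × A) := {q | c q.1 = c q.2 ∧ q.1 ≠ q.2}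
  have hS : MeasurableSet S :=
    (measurableSet_eq_fun (hc.comp measurable_fst) (hc.comp measurable_snd)).inter hoff
  rw [lt_div_iff₀ (by linarith [hm 0])] at hcε
  let νu : Measure ((Fin n → Bool) → W) := Measure.pi fun _ => ν
  let I : ((Fin n → Bool) → W) × A × A → ℝ := fun p =>
    ℓ (B ^ 2 - inner ℝ (H (p.2.1, p.1 (c p.2.1))) (H (p.2.2, p.1 (c p.2.2))))
  have hev : Measurable fun p : ((Fin n → Bool) → W) × (Fin n → Bool) => p.1 p.2 :=
    measurable_from_prod_countable_left fun i => measurable_pi_apply i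
  have hI : Measurable I := by
    refine hℓ.comp (measurable_const.sub (Measurable.inner ?_ ?_))
    · exact hH.comp (measurable_snd.fst.prodMk
        (hev.comp (measurable_fst.prodMk (hc.comp measurable_snd.fst))))
    · exact hH.comp (measurable_snd.snd.prodMk
        (hev.comp (measurable_fst.prodMk (hc.comp measurable_snd.snd))))
  have hIC : ∀ p, ‖I p‖ ≤ C := fun p => hC _ (harg _ _).1
  have hIi : Integrable I (νu.prod (μ.prod μ)) := hI.integrable_of_norm_le hIC
  have hIs : ∀ q, Integrable (fun u => I (u, q)) νu := fun q =>
    (hI.comp (by fun_prop)).integrable_of_norm_le fun _ => hIC _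
  -- On the diagonal the section has loss exactly `ℓ 0`. Across cells its mean loss is exactly `G`.
  -- Within a cell it is at most `ℓ 0`, while `G` is at least `m`.
  have hpt : ∀ q, ∫ u, I (u, q) ∂νu ≤
      Q q - off.indicator (fun q => Q q - G q) q + S.indicator (fun _ => ℓ 0 - m) q := by
    rintro ⟨r, r'⟩
    by_cases hrr : r = r'
    · subst hrr
      have h1 : (r, r) ∉ off := fun h => h rfl
      have h2 : (r, r) ∉ S := fun h => h.2 rfl
      rw [Set.indicator_of_notMem h1, Set.indicator_of_notMem h2]
      have h3 : ∀ u, I (u, (r, r)) = ℓ 0 := fun u => by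
        simp only [I, inner_self_of_norm_eq (hB _), sub_self]
      simp only [h3, integral_const, probReal_univ, one_smul]
      simpa using hdiagQ r
    have h1 : (r, r') ∈ off := hrr
    rw [Set.indicator_of_mem h1]
    by_cases hcc : c r = c r'
    · have h2 : (r, r') ∈ S := ⟨hcc, hrr⟩
      rw [Set.indicator_of_mem h2]
      have h3 := integral_mono (hIs (r, r')) (integrable_const (ℓ 0))
        fun u => hdec.antitone (harg _ _).2
      simp only [integral_const, probReal_univ, one_smul] at h3
      linarith [hmG (r, r')]
    · have h2 : (r, r') ∉ S := fun h => hcc h.1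
      rw [Set.indicator_of_notMem h2]
      refine le_of_eq ?_
      have hk : Measurable fun w : W × W => ℓ (B ^ 2 - inner ℝ (H (r, w.1)) (H (r', w.2))) :=
        hℓ.comp (measurable_const.sub (Measurable.inner (by fun_prop) (by fun_prop)))
      have h3 := (measurePreserving_eval_pair ν hcc).integral_comp_of_aestronglyMeasurable
        hk.aestronglyMeasurable
      have hmp : MeasurePreserving (Prod.map id Prod.snd : W × W × W → W × W) ν3 (ν.prod ν) :=
        (MeasurePreserving.id ν).prod measurePreserving_snd
      have h4 := hmp.integral_comp_of_aestronglyMeasurable hk.aestronglyMeasurable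
      have h5 : ∫ u, I (u, (r, r')) ∂νu = G (r, r') := h3.trans h4.symm
      rw [h5]; ring
  -- Some draw does no worse than the average and avoids the null set in every cell.
  obtain ⟨u, huN, hu⟩ := exists_notMem_null_le_integral (μ := νu)
    (N := ⋃ i, Function.eval i ⁻¹' N) hIi.integral_prod_left
    (measure_iUnion_null fun i => Measure.pi_eval_preimage_null (fun _ : Fin n → Bool => ν) hN)
  refine ⟨n, c, u, hc, fun a ha => huN (Set.mem_iUnion.mpr ⟨a, ha⟩), lt_of_le_of_lt hu ?_⟩
  rw [integral_integral_swap (f := fun u q => I (u, q)) hIi]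
  have hSi : Integrable (S.indicator fun _ => ℓ 0 - m) (μ.prod μ) :=
    (integrable_const _).indicator hS
  refine lt_of_le_of_lt (integral_mono hIi.integral_prod_right ((hQi.sub hQG).add hSi) hpt) ?_
  rw [integral_add' (hQi.sub hQG) hSi, integral_sub' hQi hQG, integral_indicator_const _ hS]
  have hL := integral_prod_prod_prod μ ν hf hfC
  refine lt_of_lt_of_eq ?_ hL.symm
  have h0 : 0 ≤ (μ.prod μ).real S := measureReal_nonneg
  rw [smul_eq_mul]
  change _ < ∫ q, Q q ∂(μ.prod μ)
  change (μ.prod μ).real S * _ < _ at hcε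
  nlinarith [hm 0]

end Sections

/-! ### Isometric embeddings with spare orthogonal directions -/

theorem EuclideanSpace.exists_linearIsometry_of_embedding {ι κ : Type*} [Fintype ι] [Fintype κ]
    [DecidableEq ι] [DecidableEq κ] (g : ι ↪ κ) :
    ∃ T : EuclideanSpace ℝ ι →ₗᵢ[ℝ] EuclideanSpace ℝ κ,
      ∀ x, T x = ∑ i, x i • EuclideanSpace.single (g i) (1 : ℝ) := by
  let b := EuclideanSpace.basisFun ι ℝ
  let L := b.toBasis.constr ℝ fun i => EuclideanSpace.single (g i) (1 : ℝ)
  have hL : L ∘ b.toBasis = fun i => EuclideanSpace.single (g i) (1 : ℝ) :=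
    funext fun i => b.toBasis.constr_basis ℝ _ i
  have horth : Orthonormal ℝ (L ∘ b.toBasis) := by
    rw [hL]
    exact (EuclideanSpace.orthonormal_single (𝕜 := ℝ) (ι := κ)).comp g g.injective
  refine ⟨L.isometryOfOrthonormal (v := b.toBasis)
    (by rw [b.coe_toBasis]; exact b.orthonormal) horth, fun x => ?_⟩
  change L x = _
  simp [L, Module.Basis.constr_apply_fintype, b, EuclideanSpace.basisFun_toBasis]

theorem exists_linearIsometry_of_le {k k' : ℕ} (h : k ≤ k') : Nonempty (Euc k →ₗᵢ[ℝ] Euc k') :=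
  ⟨(EuclideanSpace.exists_linearIsometry_of_embedding (Fin.castLEEmb h)).choose⟩

/-- `ℝ^k` embeds isometrically into `ℝ^k'` with room for orthonormal vectors indexed by `ι`. -/
theorem exists_linearIsometry_orthonormal {k k' : ℕ} {ι : Type*} [Fintype ι] [DecidableEq ι]
    (h : k + Fintype.card ι ≤ k') :
    ∃ (T : Euc k →ₗᵢ[ℝ] Euc k') (e : ι → Euc k'), Orthonormal ℝ e ∧
      ∀ x i, inner ℝ (T x) (e i) = 0 := by
  obtain ⟨f⟩ : Nonempty (Fin k ⊕ ι ↪ Fin k') :=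
    Function.Embedding.nonempty_of_card_le (by simpa using h)
  obtain ⟨T, hT⟩ := EuclideanSpace.exists_linearIsometry_of_embedding
    (Function.Embedding.inl.trans f)
  refine ⟨T, fun i => EuclideanSpace.single (f (Sum.inr i)) 1,
    (EuclideanSpace.orthonormal_single (𝕜 := ℝ)).comp _ (f.injective.comp Sum.inr_injective),
    fun x i => ?_⟩
  rw [hT, sum_inner]
  refine Finset.sum_eq_zero fun j _ => ?_
  simp [inner_smul_left, EuclideanSpace.inner_single_left]

/-! ### The relaxed problem -/

section Relaxation

variable {A : Type*} [MeasurableSpace A]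

/-- The loss of a pair of points when equal points get the loss `ℓ 0`, while the representations
`v` of distinct points need not have norm `B`. -/
noncomputable def relaxedLoss {E : Type*} [NormedAddCommGroup E] [InnerProductSpace ℝ E]
    (ℓ : ℝ → ℝ) (B : ℝ) (v : A → E) (q : A × A) : ℝ :=
  open Classical in if q.1 = q.2 then ℓ 0 else ℓ (B ^ 2 - inner ℝ (v q.1) (v q.2))

theorem abs_inner_le_of_norm_le {E : Type*} [NormedAddCommGroup E] [InnerProductSpace ℝ E]
    {B : ℝ} {x y : E} (hx : ‖x‖ ≤ B) (hy : ‖y‖ ≤ B) : |inner ℝ x y| ≤ B ^ 2 := by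
  have := abs_real_inner_le_norm x y
  nlinarith [norm_nonneg x, norm_nonneg y]

theorem abs_sq_sub_inner_le {E : Type*} [NormedAddCommGroup E] [InnerProductSpace ℝ E]
    {B : ℝ} {x y : E} (hx : ‖x‖ ≤ B) (hy : ‖y‖ ≤ B) : |B ^ 2 - inner ℝ x y| ≤ 2 * B ^ 2 := by
  have h := abs_le.mp (abs_inner_le_of_norm_le hx hy)
  exact abs_le.mpr ⟨by linarith, by linarith⟩

theorem aestronglyMeasurable_loss {E : Type*} [NormedAddCommGroup E] [InnerProductSpace ℝ E]
    {ℓ : ℝ → ℝ} (hℓ : Continuous ℓ) (B : ℝ) {v : A → E} {μ ν : Measure A}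
    [SFinite μ] [SFinite ν] (hμ : AEStronglyMeasurable v μ) (hν : AEStronglyMeasurable v ν) :
    AEStronglyMeasurable (fun q : A × A => ℓ (B ^ 2 - inner ℝ (v q.1) (v q.2))) (μ.prod ν) :=
  hℓ.comp_aestronglyMeasurable
    (aestronglyMeasurable_const.sub ((hμ.comp_fst (ν := ν)).inner (hν.comp_snd (μ := μ))))

theorem integrable_loss {E : Type*} [NormedAddCommGroup E] [InnerProductSpace ℝ E]
    {ℓ : ℝ → ℝ} (hℓ : Continuous ℓ) {B : ℝ} {v : A → E} {μ ν : Measure A}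
    [IsFiniteMeasure μ] [IsFiniteMeasure ν] (hμ : AEStronglyMeasurable v μ)
    (hν : AEStronglyMeasurable v ν) (hv : ∀ a, ‖v a‖ ≤ B) :
    Integrable (fun q : A × A => ℓ (B ^ 2 - inner ℝ (v q.1) (v q.2))) (μ.prod ν) := by
  obtain ⟨C, hC⟩ := hℓ.exists_norm_le_of_abs_le (2 * B ^ 2)
  exact Integrable.of_bound (aestronglyMeasurable_loss hℓ B hμ hν) C
    (ae_of_all _ fun q => hC _ (abs_sq_sub_inner_le (hv _) (hv _)))

variable [MeasurableEq A]

theorem integrable_relaxedLoss {E : Type*} [NormedAddCommGroup E] [InnerProductSpace ℝ E]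
    {ℓ : ℝ → ℝ} (hℓ : Continuous ℓ) {B : ℝ} {v : A → E} {μ : Measure A} [IsFiniteMeasure μ]
    (hv : AEStronglyMeasurable v μ) (hvB : ∀ a, ‖v a‖ ≤ B) :
    Integrable (relaxedLoss ℓ B v) (μ.prod μ) := by
  classical
  have hd : MeasurableSet {q : A × A | q.1 = q.2} :=
    (measurableSet_diagonal : MeasurableSet (Set.diagonal A))
  have h1 : Integrable (fun _ : A × A => ℓ 0) (μ.prod μ) := integrable_const _
  exact Integrable.piecewise (f := fun _ => ℓ 0) hd h1.integrableOn
    (integrable_loss hℓ hv hv hvB).integrableOn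

/-- Each cell receives its own unit vector orthogonal to the image of `v`, scaled to bring the norm
up to `B`. Inner products across cells are those of `v`; only distinct points in one cell can lose,
and they are rare. The cells do not depend on `k'`, which can thus be picked afterwards in an
unbounded set of dimensions. -/
theorem exists_integral_lt_relaxedLoss [MeasurableSpace.CountablyGenerated A]
    [MeasurableSpace.SeparatesPoints A] {ℓ : ℝ → ℝ} (hℓ : Continuous ℓ) (hdec : StrictAnti ℓ)
    {m : ℝ} (hm : ∀ x, m ≤ ℓ x) (μ : Measure A) [IsProbabilityMeasure μ] {k : ℕ} {B : ℝ}
    (hB : 0 ≤ B) {v : A → Euc k} (hv : AEStronglyMeasurable v μ) (hvB : ∀ a, ‖v a‖ ≤ B) {ε : ℝ}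
    (hε : 0 < ε) :
    ∃ (n : ℕ) (c : A → Fin n → Bool), Measurable c ∧ ∀ k', k + Fintype.card (Fin n → Bool) ≤ k' →
      ∃ (T : Euc k →ₗᵢ[ℝ] Euc k') (e : (Fin n → Bool) → Euc k'),
        let ψ := fun a => T (v a) + √(B ^ 2 - ‖v a‖ ^ 2) • e (c a)
        (∀ a, ‖ψ a‖ = B) ∧ AEStronglyMeasurable ψ μ ∧
        ∫ q, ℓ (B ^ 2 - inner ℝ (ψ q.1) (ψ q.2)) ∂(μ.prod μ) <
          ∫ q, relaxedLoss ℓ B v q ∂(μ.prod μ) + ε := by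
  obtain ⟨n, c, hc, hcε⟩ := exists_measurable_cells (μ.prod μ)
    (show 0 < ε / (ℓ 0 - m + 1) from div_pos hε (by linarith [hm 0]))
  rw [lt_div_iff₀ (by linarith [hm 0])] at hcε
  refine ⟨n, c, hc, fun k' hk' => ?_⟩
  obtain ⟨T, e, he, hTe⟩ := exists_linearIsometry_orthonormal hk'
  have hs : ∀ a, 0 ≤ B ^ 2 - ‖v a‖ ^ 2 := fun a => by
    have := hvB a; nlinarith [norm_nonneg (v a)]
  refine ⟨T, e, ?_⟩
  intro ψ
  have hinner : ∀ a b, inner ℝ (ψ a) (ψ b) = inner ℝ (v a) (v b) +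
      √(B ^ 2 - ‖v a‖ ^ 2) * √(B ^ 2 - ‖v b‖ ^ 2) * inner ℝ (e (c a)) (e (c b)) := by
    intro a b
    have h1 := hTe (v a) (c b)
    have h2 := hTe (v b) (c a)
    rw [real_inner_comm] at h2
    simp only [ψ, inner_add_left, inner_add_right, inner_smul_left, inner_smul_right, h1, h2,
      T.inner_map_map]
    simp
    ring
  have hψB : ∀ a, ‖ψ a‖ = B := by
    intro a
    have h1 := hinner a a
    rw [real_inner_self_eq_norm_sq, real_inner_self_eq_norm_sq, real_inner_self_eq_norm_sq,
      he.1 (c a), Real.mul_self_sqrt (hs a)] at h1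
    exact (sq_eq_sq₀ (norm_nonneg _) hB).mp (by linarith)
  have hψm : AEStronglyMeasurable ψ μ := by
    refine (T.continuous.comp_aestronglyMeasurable hv).add
      (AEStronglyMeasurable.fun_smul (f := fun a => √(B ^ 2 - ‖v a‖ ^ 2)) ?_ ?_)
    · exact Real.continuous_sqrt.comp_aestronglyMeasurable
        (aestronglyMeasurable_const.sub (hv.norm.pow 2))
    · exact ((measurable_of_finite e).comp hc).aestronglyMeasurable
  refine ⟨hψB, hψm, ?_⟩
  let S : Set (A × A) := {q | c q.1 = c q.2 ∧ q.1 ≠ q.2}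
  have hS : MeasurableSet S :=
    (measurableSet_eq_fun (hc.comp measurable_fst) (hc.comp measurable_snd)).inter
      (measurableSet_diagonal : MeasurableSet (Set.diagonal A)).compl
  have hpt : ∀ q : A × A, ℓ (B ^ 2 - inner ℝ (ψ q.1) (ψ q.2)) ≤
      relaxedLoss ℓ B v q + S.indicator (fun _ => ℓ 0 - m) q := by
    rintro ⟨a, b⟩
    by_cases hab : a = b
    · subst hab
      have h2 : (a, a) ∉ S := fun h => h.2 rfl
      rw [Set.indicator_of_notMem h2, relaxedLoss, if_pos rfl]
      simp [hψB a]
    · rw [relaxedLoss, if_neg (show ¬ (a, b).1 = (a, b).2 from hab)]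
      by_cases hcc : c a = c b
      · rw [Set.indicator_of_mem (show (a, b) ∈ S from ⟨hcc, hab⟩)]
        have h1 : ℓ (B ^ 2 - inner ℝ (ψ a) (ψ b)) ≤ ℓ 0 := hdec.antitone (by
          linarith [abs_le.mp (abs_inner_le_of_norm_eq (hψB a) (hψB b))])
        linarith [hm (B ^ 2 - inner ℝ (v a) (v b))]
      · rw [Set.indicator_of_notMem (fun h : (a, b) ∈ S => hcc h.1)]
        simp only [hinner, he.2 hcc, mul_zero, add_zero, le_refl]
  have hSi : Integrable (S.indicator fun _ => ℓ 0 - m) (μ.prod μ) :=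
    (integrable_const _).indicator hS
  have hR := integrable_relaxedLoss hℓ hv hvB
  refine lt_of_le_of_lt (integral_mono (integrable_loss hℓ hψm hψm fun a => (hψB a).le)
    (hR.add hSi) hpt) ?_
  rw [integral_add' hR hSi, integral_indicator_const _ hS, smul_eq_mul]
  have h0 : 0 ≤ (μ.prod μ).real S := measureReal_nonneg
  change (μ.prod μ).real S * _ < _ at hcε
  nlinarith [hm 0]

end Relaxation

/-! ### Atoms and the nonatomic part -/

section Atoms

variable {A : Type*} [MeasurableSpace A] [MeasurableSingletonClass A]

theorem countable_setOf_measure_singleton_ne_zero (μ : Measure A) [SFinite μ] :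
    {a : A | μ {a} ≠ 0}.Countable := by
  have := Measure.countable_meas_pos_of_disjoint_iUnion (μ := μ) (As := fun a : A => {a})
    (fun a => measurableSet_singleton a) (fun a b hab => by simpa using hab)
  simpa only [pos_iff_ne_zero] using this

theorem measurableSet_setOf_measure_singleton_eq_zero (μ : Measure A) [SFinite μ] :
    MeasurableSet {a : A | μ {a} = 0} := by
  have := (countable_setOf_measure_singleton_ne_zero μ).measurableSet.compl
  convert this using 1
  ext a; simp

theorem ae_ne_prod_restrict_nonatomic [MeasurableEq A] (μ : Measure A) [SFinite μ] :
    ∀ᵐ q ∂((μ.restrict {a | μ {a} = 0}).prod (μ.restrict {a | μ {a} = 0})), q.1 ≠ q.2 := by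
  rw [ae_iff]
  have hd : MeasurableSet {q : A × A | ¬ q.1 ≠ q.2} := by
    simp only [ne_eq, not_not]
    exact (measurableSet_diagonal : MeasurableSet (Set.diagonal A))
  rw [Measure.measure_prod_null hd]
  refine ae_of_all _ fun a => ?_
  change (μ.restrict {a | μ {a} = 0}) (Prod.mk a ⁻¹' {q : A × A | ¬ q.1 ≠ q.2}) = 0
  have h1 : Prod.mk a ⁻¹' {q : A × A | ¬ q.1 ≠ q.2} = {a} := by
    ext b; simp [eq_comm]
  rw [h1, Measure.restrict_apply (measurableSet_singleton a)]
  by_cases ha : μ {a} = 0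
  · exact measure_mono_null Set.inter_subset_left ha
  · rw [Set.singleton_inter_eq_empty.mpr (by simpa using ha)]; simp

end Atoms

/-! ### Nonexistence of optima with a nonatomic part -/

section Optimum

variable {A : Type*} [MeasurableSpace A]

theorem integral_inner_left_const {E : Type*} [NormedAddCommGroup E] [InnerProductSpace ℝ E]
    [CompleteSpace E] {μ : Measure A} {f : A → E} (hf : Integrable f μ) (x : E) :
    ∫ a, inner ℝ (f a) x ∂μ = inner ℝ (∫ a, f a ∂μ) x := by
  rw [real_inner_comm, ← integral_inner hf x]
  simp only [real_inner_comm]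

theorem exists_prod_mem_of_ae_prod {μ : Measure A} [SFinite μ] {P : Set A} (hP : μ P ≠ 0)
    {p : A × A → Prop} (h : ∀ᵐ q ∂(μ.prod μ), p q) : ∃ q, q.1 ∈ P ∧ q.2 ∈ P ∧ p q := by
  by_contra! hcon
  have h1 : (μ.prod μ) (P ×ˢ P) = 0 :=
    measure_mono_null (fun q hq => hcon q hq.1 hq.2) h
  rw [Measure.prod_prod] at h1
  simp [hP] at h1

/-- Within a nonzero measure, independent points are mapped close together by a map into a
second countable space. -/
theorem exists_dist_lt_of_ae_prod {E : Type*} [NormedAddCommGroup E] [SecondCountableTopology E]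
    {μ : Measure A} [SFinite μ] (hμ : μ ≠ 0) {ψ : A → E} (hψ : AEStronglyMeasurable ψ μ)
    {p : A × A → Prop} (h : ∀ᵐ q ∂(μ.prod μ), p q) {δ : ℝ} (hδ : 0 < δ) :
    ∃ q : A × A, ‖ψ q.1 - ψ q.2‖ < δ ∧ p q := by
  borelize E
  have h1 : μ.map ψ ≠ 0 := by
    rwa [Ne, Measure.map_eq_zero_iff hψ.aemeasurable]
  obtain ⟨x, hx⟩ := Measure.nonempty_support h1
  have h2 := (Measure.mem_support_iff_forall x).mp hx _ (Metric.ball_mem_nhds x (half_pos hδ))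
  rw [Measure.map_apply_of_aemeasurable hψ.aemeasurable Metric.isOpen_ball.measurableSet] at h2
  obtain ⟨q, hq1, hq2, hq⟩ := exists_prod_mem_of_ae_prod h2.ne' h
  refine ⟨q, ?_, hq⟩
  rw [← dist_eq_norm]
  have h3 := dist_triangle_right (ψ q.1) (ψ q.2) x
  have h4 := Metric.mem_ball.mp hq1
  have h5 := Metric.mem_ball.mp hq2
  linarith

variable [MeasurableEq A]

/-- If replacing `ψ` by `w` on the nonatomic part of `μ` does not lower the relaxed loss, then
the loss that `ψ` loses inside the nonatomic part is made up for elsewhere. -/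
theorem integral_sub_add_le_zero {E : Type*} [NormedAddCommGroup E] [InnerProductSpace ℝ E]
    {ℓ : ℝ → ℝ} (hℓ : Continuous ℓ) (μ : Measure A) [IsProbabilityMeasure μ] {B : ℝ}
    {ψ : A → E} (hψ : AEStronglyMeasurable ψ μ) (hψB : ∀ a, ‖ψ a‖ = B) {C : Set A}
    (hC : C = {a | μ {a} = 0}) [DecidablePred (· ∈ C)] {w : E} (hw : ‖w‖ ≤ B)
    (hopt : ∫ q, ℓ (B ^ 2 - inner ℝ (ψ q.1) (ψ q.2)) ∂(μ.prod μ) ≤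
      ∫ q, relaxedLoss ℓ B (C.piecewise (fun _ => w) ψ) q ∂(μ.prod μ)) :
    ∫ q, (ℓ (B ^ 2 - inner ℝ (ψ q.1) (ψ q.2)) - ℓ (B ^ 2 - ‖w‖ ^ 2))
        ∂((μ.restrict C).prod (μ.restrict C)) +
      2 * ∫ q, (ℓ (B ^ 2 - inner ℝ (ψ q.1) (ψ q.2)) - ℓ (B ^ 2 - inner ℝ w (ψ q.2)))
        ∂((μ.restrict C).prod (μ.restrict Cᶜ)) ≤ 0 := by
  have hCm : MeasurableSet C := hC ▸ measurableSet_setOf_measure_singleton_eq_zero μ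
  set v : A → E := C.piecewise (fun _ => w) ψ with hv
  have hvC : ∀ a ∈ C, v a = w := fun a ha => Set.piecewise_eq_of_mem _ _ _ ha
  have hvD : ∀ a ∈ Cᶜ, v a = ψ a := fun a ha => Set.piecewise_eq_of_notMem _ _ _ ha
  have hvB : ∀ a, ‖v a‖ ≤ B := fun a => by
    by_cases ha : a ∈ C
    · rw [hvC a ha]; exact hw
    · rw [hvD a ha]; exact (hψB a).le
  have hvm : AEStronglyMeasurable v μ :=
    AEStronglyMeasurable.piecewise hCm aestronglyMeasurable_const hψ.restrict
  let f : A × A → ℝ := fun q => ℓ (B ^ 2 - inner ℝ (ψ q.1) (ψ q.2))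
  have hf : Integrable f (μ.prod μ) := integrable_loss hℓ hψ hψ fun a => (hψB a).le
  have hF : Integrable (relaxedLoss ℓ B v) (μ.prod μ) := integrable_relaxedLoss hℓ hvm hvB
  let h : A × A → ℝ := fun q => f q - relaxedLoss ℓ B v q
  have hh : Integrable h (μ.prod μ) := hf.sub hF
  have h0 : ∫ q, h q ∂(μ.prod μ) ≤ 0 := by
    simp only [h]; rw [integral_sub hf hF]; linarith
  set μC := μ.restrict C with hμC
  set μD := μ.restrict Cᶜ with hμD
  -- Four blocks: inside `C` the diagonal is null, so the relaxed loss is constant; the mixed blocks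
  -- agree by symmetry, whence the factor 2; off `C` nothing has changed.
  have hsum : μ.prod μ = (μC.prod μC + μD.prod μC) + (μC.prod μD + μD.prod μD) := by
    rw [← Measure.add_prod, ← Measure.add_prod, ← Measure.prod_add,
      Measure.restrict_add_restrict_compl hCm]
  rw [hsum] at h0 hh
  have i1 := hh.left_of_add_measure
  have i2 := hh.right_of_add_measure
  rw [integral_add_measure i1 i2,
    integral_add_measure i1.left_of_add_measure i1.right_of_add_measure,
    integral_add_measure i2.left_of_add_measure i2.right_of_add_measure] at h0
  have mC : ∀ᵐ a ∂μC, a ∈ C := ae_restrict_mem hCm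
  have mD : ∀ᵐ a ∂μD, a ∈ Cᶜ := ae_restrict_mem hCm.compl
  have e1 : ∫ q, h q ∂(μC.prod μC) =
      ∫ q, (f q - ℓ (B ^ 2 - ‖w‖ ^ 2)) ∂(μC.prod μC) := by
    refine integral_congr_ae ?_
    filter_upwards [Measure.quasiMeasurePreserving_fst.ae mC,
      Measure.quasiMeasurePreserving_snd.ae mC,
      (by rw [hμC, hC]; exact ae_ne_prod_restrict_nonatomic μ :
        ∀ᵐ q ∂(μC.prod μC), q.1 ≠ q.2)] with q h1 h2 h3
    simp only [h, relaxedLoss, if_neg h3, hvC _ h1, hvC _ h2, real_inner_self_eq_norm_sq]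
  have e2 : ∫ q, h q ∂(μC.prod μD) =
      ∫ q, (f q - ℓ (B ^ 2 - inner ℝ w (ψ q.2))) ∂(μC.prod μD) := by
    refine integral_congr_ae ?_
    filter_upwards [Measure.quasiMeasurePreserving_fst.ae mC,
      Measure.quasiMeasurePreserving_snd.ae mD] with q h1 h2
    have h3 : ¬ q.1 = q.2 := fun h => h2 (h ▸ h1)
    simp only [h, relaxedLoss, if_neg h3, hvC _ h1, hvD _ h2]
  have e3 : ∫ q, h q ∂(μD.prod μC) = ∫ q, h q ∂(μC.prod μD) := by
    rw [← integral_prod_swap]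
    refine integral_congr_ae (ae_of_all _ fun q => ?_)
    by_cases h3 : q.1 = q.2
    · simp only [h, f, relaxedLoss, Prod.fst_swap, Prod.snd_swap, h3]
    · simp only [h, f, relaxedLoss, Prod.fst_swap, Prod.snd_swap, if_neg h3, if_neg (Ne.symm h3),
        real_inner_comm (ψ q.2), real_inner_comm (v q.2)]
  have e4 : ∫ q, h q ∂(μD.prod μD) = 0 := by
    refine integral_eq_zero_of_ae ?_
    filter_upwards [Measure.quasiMeasurePreserving_fst.ae mD,
      Measure.quasiMeasurePreserving_snd.ae mD] with q h1 h2
    simp only [h, f, relaxedLoss, hvD _ h1, hvD _ h2, Pi.zero_apply]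
    split_ifs with h3
    · rw [h3, inner_self_of_norm_eq (hψB _), sub_self, sub_self]
    · exact sub_self _
  rw [e3, e4, e1, e2] at h0
  linarith

/-- With a nonatomic part and a large norm, no representation is optimal for the relaxed
problem: optimality would force `ℓ` to be affine on a long interval. -/
theorem not_relaxed_optimal {E : Type*} [NormedAddCommGroup E] [InnerProductSpace ℝ E]
    [CompleteSpace E] [SecondCountableTopology E] {ℓ : ℝ → ℝ} (hconv : ConvexOn ℝ Set.univ ℓ)
    (hdec : StrictAnti ℓ) {m : ℝ} (hm : ∀ x, m ≤ ℓ x) (μ : Measure A) [IsProbabilityMeasure μ]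
    {B : ℝ} (hB : 0 ≤ B) {ψ : A → E} (hψ : AEStronglyMeasurable ψ μ) (hψB : ∀ a, ‖ψ a‖ = B)
    {C : Set A} (hC : C = {a | μ {a} = 0}) [DecidablePred (· ∈ C)] (hpos : 0 < μ.real C)
    (hopt : ∀ w : E, ‖w‖ ≤ B → ∫ q, ℓ (B ^ 2 - inner ℝ (ψ q.1) (ψ q.2)) ∂(μ.prod μ) ≤
      ∫ q, relaxedLoss ℓ B (C.piecewise (fun _ => w) ψ) q ∂(μ.prod μ)) :
    μ.real C ^ 2 * (ℓ ((ℓ 0 - m) / (ℓ 0 - ℓ 1)) - m) ≤ 2 * (ℓ (B ^ 2) - m) := by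
  have hℓ := hconv.continuous_of_univ
  have hCm : MeasurableSet C := hC ▸ measurableSet_setOf_measure_singleton_eq_zero μ
  set c := μ.real C with hc
  set μC := μ.restrict C with hμC
  set μD := μ.restrict Cᶜ with hμD
  have hCr : μC.real Set.univ = c := by simp [hμC, hc]
  have hDr : μD.real Set.univ = 1 - c := by
    simp [hμD, hc, probReal_compl_eq_one_sub hCm]
  have hc1 : c ≤ 1 := measureReal_le_one
  have hψC : AEStronglyMeasurable ψ μC := hψ.restrict
  have hψD : AEStronglyMeasurable ψ μD := hψ.restrict
  have hψi : Integrable ψ μC := Integrable.of_bound hψC B (ae_of_all _ fun a => (hψB a).le)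
  have hψB' : ∀ a, ‖ψ a‖ ≤ B := fun a => (hψB a).le
  let X : A × A → ℝ := fun q => inner ℝ (ψ q.1) (ψ q.2)
  let f : A × A → ℝ := fun q => ℓ (B ^ 2 - X q)
  have hfC : Integrable f (μC.prod μC) := integrable_loss hℓ hψC hψC hψB'
  have hfD : Integrable f (μC.prod μD) := integrable_loss hℓ hψC hψD hψB'
  have hX : Integrable X (μC.prod μC) :=
    Integrable.of_bound ((hψC.comp_fst (ν := μC)).inner (hψC.comp_snd (μ := μC))) (B ^ 2)
      (ae_of_all _ fun q => abs_inner_le_of_norm_le (hψB' _) (hψB' _))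
  -- `w` is the mean of `ψ` over `C`. The inner product of two independent points of `C` then has
  -- mean `‖w‖ ^ 2`, so the argument of `ℓ` has mean `e`.
  obtain ⟨w, hcw⟩ : ∃ w : E, ∫ a, ψ a ∂μC = c • w :=
    ⟨c⁻¹ • ∫ a, ψ a ∂μC, by simp [hpos.ne']⟩
  have hwB : ‖w‖ ≤ B := by
    have h1 : ‖∫ a, ψ a ∂μC‖ ≤ B * μC.real Set.univ :=
      norm_integral_le_of_norm_le_const (ae_of_all _ hψB')
    rw [hcw, norm_smul, Real.norm_of_nonneg hpos.le, hCr, mul_comm] at h1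
    exact le_of_mul_le_mul_right h1 hpos
  have hXint : ∫ q, X q ∂(μC.prod μC) = c ^ 2 * ‖w‖ ^ 2 := by
    rw [integral_prod _ hX]
    have h1 : ∀ a, ∫ b, X (a, b) ∂μC = inner ℝ (ψ a) (c • w) := fun a => by
      rw [← hcw]; exact integral_inner hψi (ψ a)
    simp only [h1]
    rw [integral_inner_left_const hψi, hcw, inner_smul_left, inner_smul_right,
      real_inner_self_eq_norm_sq]
    simp; ring
  -- Jensen's inequality, one point in the nonatomic part
  have hJ : 0 ≤ ∫ q, (f q - ℓ (B ^ 2 - inner ℝ w (ψ q.2))) ∂(μC.prod μD) := by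
    have hgi : Integrable (fun q : A × A => ℓ (B ^ 2 - inner ℝ w (ψ q.2))) (μC.prod μD) := by
      obtain ⟨K, hK⟩ := hℓ.exists_norm_le_of_abs_le (2 * B ^ 2)
      refine Integrable.of_bound (hℓ.comp_aestronglyMeasurable (aestronglyMeasurable_const.sub
        (aestronglyMeasurable_const.inner (hψD.comp_snd (μ := μC))))) K
        (ae_of_all _ fun q => hK _ (abs_sq_sub_inner_le hwB (hψB' _)))
    have h2 := integral_prod_symm _ (hfD.sub hgi)
    simp only [Pi.sub_apply] at h2
    rw [h2]
    refine integral_nonneg fun b => ?_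
    obtain ⟨s, hs⟩ := hconv.exists_forall_add_mul_le (B ^ 2 - inner ℝ w (ψ b))
    have hin : Integrable (fun a => s * (inner ℝ w (ψ b) - inner ℝ (ψ a) (ψ b))) μC :=
      ((integrable_const _).sub (hψi.inner_const _)).const_mul s
    have h0 : ∫ a, s * (inner ℝ w (ψ b) - inner ℝ (ψ a) (ψ b)) ∂μC = 0 := by
      rw [integral_const_mul, integral_sub (integrable_const _) (hψi.inner_const _),
        integral_inner_left_const hψi, hcw, inner_smul_left, integral_const, hCr]
      simp
    change 0 ≤ ∫ a, (f (a, b) - ℓ (B ^ 2 - inner ℝ w (ψ b))) ∂μC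
    rw [← h0]
    refine integral_mono hin ?_ fun a => ?_
    · obtain ⟨K, hK⟩ := hℓ.exists_norm_le_of_abs_le (2 * B ^ 2)
      refine (Integrable.of_bound (hℓ.comp_aestronglyMeasurable (aestronglyMeasurable_const.sub
        (hψC.inner aestronglyMeasurable_const))) K
        (ae_of_all _ fun q => hK _ (abs_sq_sub_inner_le (hψB' _) (hψB' _)))).sub
        (integrable_const _)
    · have := hs (B ^ 2 - inner ℝ (ψ a) (ψ b))
      simp only [f, X]
      linarith
  have hsplit := integral_sub_add_le_zero hℓ μ hψ hψB hC hwB (hopt w hwB)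
  set e := B ^ 2 - ‖w‖ ^ 2 with he
  have he0 : 0 ≤ e := sub_nonneg.mpr (pow_le_pow_left₀ (norm_nonneg w) hwB 2)
  have hfe : ∫ q, (f q - ℓ e) ∂(μC.prod μC) ≤ 0 := by
    change ∫ q, (f q - ℓ e) ∂(μC.prod μC) + 2 * _ ≤ 0 at hsplit
    change 0 ≤ ∫ q, (ℓ (B ^ 2 - inner ℝ (ψ q.1) (ψ q.2)) - _) ∂(μC.prod μD) at hJ
    linarith
  -- equality in Jensen's inequality inside the nonatomic part
  obtain ⟨s, hs⟩ := hconv.exists_forall_add_mul_le e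
  have hCC : (μC.prod μC).real Set.univ = c ^ 2 := by
    rw [← Set.univ_prod_univ, measureReal_prod_prod, hCr, sq]
  have hlin : Integrable (fun q => s * (B ^ 2 - X q - e)) (μC.prod μC) :=
    (((integrable_const _).sub hX).sub (integrable_const _)).const_mul s
  have hlin0 : ∫ q, s * (B ^ 2 - X q - e) ∂(μC.prod μC) = 0 := by
    have h1 : ∀ q, B ^ 2 - X q - e = ‖w‖ ^ 2 - X q := fun q => by simp only [he]; ring
    simp only [h1]
    rw [integral_const_mul, integral_sub (integrable_const _) hX, hXint, integral_const, hCC,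
      smul_eq_mul, sub_self, mul_zero]
  have hfei : Integrable (fun q => f q - ℓ e) (μC.prod μC) := hfC.sub (integrable_const _)
  have hnn : ∀ q, 0 ≤ (f q - ℓ e) - s * (B ^ 2 - X q - e) := fun q => by
    have := hs (B ^ 2 - X q); simp only [f]; linarith
  have hz : ∫ q, ((f q - ℓ e) - s * (B ^ 2 - X q - e)) ∂(μC.prod μC) = 0 := by
    refine le_antisymm ?_ (integral_nonneg hnn)
    rw [integral_sub hfei hlin, hlin0]; linarith
  have hae := (integral_eq_zero_iff_of_nonneg hnn (hfei.sub hlin)).mp hz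
  have hμC0 : μC ≠ 0 := fun h => by
    rw [h] at hCr; simp at hCr; exact hpos.ne hCr
  -- Almost every pair puts `B ^ 2 - X` where `ℓ` meets its supporting line at `e`. Pairs with
  -- nearly equal images make `B ^ 2 - X`, half their squared distance, tend to `0`; this explains
  -- the radius `√δ`.
  have haff : ℓ 0 = ℓ e + s * (0 - e) := by
    have hcl : IsClosed {x | ℓ x = ℓ e + s * (x - e)} :=
      isClosed_eq hℓ (by fun_prop)
    refine hcl.closure_subset (Metric.mem_closure_iff.mpr fun δ hδ => ?_)
    obtain ⟨q, hq1, hq2⟩ := exists_dist_lt_of_ae_prod hμC0 hψC hae (Real.sqrt_pos.mpr hδ)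
    refine ⟨B ^ 2 - X q, ?_, ?_⟩
    · simp only [Pi.zero_apply] at hq2
      change ℓ (B ^ 2 - X q) = _
      simp only [f] at hq2
      linarith
    · have h1 := norm_sub_sq_real (ψ q.1) (ψ q.2)
      rw [hψB, hψB] at h1
      have h2 : ‖ψ q.1 - ψ q.2‖ ^ 2 < δ := by
        rw [← Real.sq_sqrt hδ.le]
        exact pow_lt_pow_left₀ hq1 (norm_nonneg _) two_ne_zero
      have h3 : 0 ≤ ‖ψ q.1 - ψ q.2‖ ^ 2 := sq_nonneg _
      rw [dist_zero_left, Real.norm_eq_abs, abs_lt]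
      simp only [X]
      constructor <;> linarith
  have h01 : ℓ 1 < ℓ 0 := hdec one_pos
  -- The supporting line passes through `(0, ℓ 0)` and lies below `ℓ` at `1`, so it falls at rate at
  -- least `ℓ 0 - ℓ 1`, and at `e` it is still at least `m`.
  have heT : e ≤ (ℓ 0 - m) / (ℓ 0 - ℓ 1) := by
    rw [le_div_iff₀ (by linarith)]
    have h1 := hs 1
    have h2 := hm e
    have h3 := mul_le_mul_of_nonneg_left (show s ≤ ℓ 1 - ℓ 0 by linarith) he0
    linarith
  have hJe : c ^ 2 * ℓ e ≤ ∫ q, f q ∂(μC.prod μC) := by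
    have h1 : 0 ≤ ∫ q, ((f q - ℓ e) - s * (B ^ 2 - X q - e)) ∂(μC.prod μC) := integral_nonneg hnn
    rw [integral_sub hfei hlin, hlin0, integral_sub hfC (integrable_const _), integral_const,
      hCC, smul_eq_mul] at h1
    linarith
  -- Second competitor: the zero vector on `C`, whose loss against every other point is `ℓ (B ^ 2)`.
  have hsplit0 := integral_sub_add_le_zero hℓ μ hψ hψB hC (w := 0) (by simpa) (hopt 0 (by simpa))
  simp only [inner_zero_left, norm_zero, ne_eq, OfNat.ofNat_ne_zero, not_false_eq_true, zero_pow,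
    sub_zero] at hsplit0
  have hCD : (μC.prod μD).real Set.univ = c * (1 - c) := by
    rw [← Set.univ_prod_univ, measureReal_prod_prod, hCr, hDr]
  have h1 : c * (1 - c) * (m - ℓ (B ^ 2)) ≤ ∫ q, (f q - ℓ (B ^ 2)) ∂(μC.prod μD) := by
    have := integral_mono (μ := μC.prod μD) (integrable_const (m - ℓ (B ^ 2)))
      (hfD.sub (integrable_const (ℓ (B ^ 2)))) fun q => sub_le_sub_right (hm _) _
    rwa [integral_const, hCD, smul_eq_mul] at this
  have h2 : ∫ q, (f q - ℓ (B ^ 2)) ∂(μC.prod μC) =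
      ∫ q, f q ∂(μC.prod μC) - c ^ 2 * ℓ (B ^ 2) := by
    rw [integral_sub hfC (integrable_const _), integral_const, hCC, smul_eq_mul]
  change ∫ q, (f q - ℓ (B ^ 2)) ∂(μC.prod μC) + 2 * ∫ q, (f q - ℓ (B ^ 2)) ∂(μC.prod μD) ≤ 0
    at hsplit0
  rw [h2] at hsplit0
  have h3 := mul_le_mul_of_nonneg_left (hdec.antitone heT) (sq_nonneg c)
  have h4 := hm (B ^ 2)
  nlinarith [mul_nonneg (sub_nonneg.mpr h4) (sq_nonneg (1 - c))]

end Optimum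

/-! ### Thresholds for the norm, separated vectors, cost of identified pairs -/

section Threshold

theorem StrictAnti.exists_forall_ge_lt_iInf_add {ℓ : ℝ → ℝ} (hdec : StrictAnti ℓ) {ε : ℝ}
    (hε : 0 < ε) : ∃ t, ∀ x, t ≤ x → ℓ x < (⨅ y, ℓ y) + ε := by
  obtain ⟨t, ht⟩ := exists_lt_of_ciInf_lt (lt_add_of_pos_right (⨅ y, ℓ y) hε)
  exact ⟨t, fun x hx => (hdec.antitone hx).trans_lt ht⟩

theorem StrictAnti.iInf_lt {ℓ : ℝ → ℝ} (hdec : StrictAnti ℓ) (hbdd : BddBelow (Set.range ℓ))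
    (x : ℝ) : ⨅ y, ℓ y < ℓ x :=
  (ciInf_le hbdd (x + 1)).trans_lt (hdec (lt_add_one x))

theorem exists_forall_ge_loss_mul_sq_lt {ℓ : ℝ → ℝ} (hdec : StrictAnti ℓ) {κ : ℝ} (hκ : 0 < κ)
    {ε : ℝ} (hε : 0 < ε) : ∃ t, 0 < t ∧ ∀ B, t ≤ B → ℓ (κ * B ^ 2) - ⨅ y, ℓ y < ε := by
  obtain ⟨t, ht⟩ := hdec.exists_forall_ge_lt_iInf_add hε
  refine ⟨max 1 (t / κ), by positivity, fun B hB => ?_⟩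
  have h1 : 1 ≤ B := (le_max_left _ _).trans hB
  have h2 : t ≤ κ * B := by
    rw [mul_comm, ← div_le_iff₀ hκ]; exact (le_max_right _ _).trans hB
  have h3 : κ * B ≤ κ * B ^ 2 := by
    have : B ≤ B ^ 2 := by nlinarith
    exact mul_le_mul_of_nonneg_left this hκ.le
  linarith [ht _ (h2.trans h3)]

theorem exists_strictAntiOn_threshold {ℓ : ℝ → ℝ} (hdec : StrictAnti ℓ)
    (hbdd : BddBelow (Set.range ℓ)) {κ : ℝ} (hκ : 0 < κ) :
    ∃ β : ℝ → ℝ, StrictAntiOn β (Set.Ioc 0 1) ∧ (∀ p ∈ Set.Ioc (0 : ℝ) 1, 0 < β p) ∧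
      ∀ p, 0 < p → ∀ B, β p ≤ B → ℓ (κ * B ^ 2) - ⨅ y, ℓ y < p * (ℓ 0 - ⨅ y, ℓ y) := by
  have h0 : 0 < ℓ 0 - ⨅ y, ℓ y := sub_pos.mpr (hdec.iInf_lt hbdd 0)
  let s : ℝ → Set ℝ := fun p =>
    {t | 0 < t ∧ ∀ B, t ≤ B → ℓ (κ * B ^ 2) - ⨅ y, ℓ y < p * (ℓ 0 - ⨅ y, ℓ y)}
  have hne : ∀ p, 0 < p → (s p).Nonempty := fun p hp =>
    exists_forall_ge_loss_mul_sq_lt hdec hκ (mul_pos hp h0)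
  have hbb : ∀ p, BddBelow (s p) := fun p => ⟨0, fun t ht => ht.1.le⟩
  have hs0 : ∀ p, 0 ≤ sInf (s p) := fun p => Real.sInf_nonneg fun t ht => ht.1.le
  -- The infimum is only weakly decreasing in `p`. Adding `1 / p` makes it strict, and places the
  -- threshold above an admissible `t`.
  refine ⟨fun p => sInf (s p) + 1 / p, ?_, ?_, ?_⟩
  · intro p hp p' hp' hpp'
    have h1 : s p ⊆ s p' := fun t ht =>
      ⟨ht.1, fun B hB => (ht.2 B hB).trans_le (mul_le_mul_of_nonneg_right hpp'.le h0.le)⟩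
    have h2 := csInf_le_csInf (hbb p') (hne p hp.1) h1
    have h3 := one_div_lt_one_div_of_lt hp.1 hpp'
    exact add_lt_add_of_le_of_lt h2 h3
  · intro p hp
    have := hs0 p
    have := one_div_pos.mpr hp.1
    positivity
  · intro p hp B hB
    have h1 : sInf (s p) < B := by
      have := one_div_pos.mpr hp
      linarith
    obtain ⟨t, ht, htB⟩ := exists_lt_of_csInf_lt (hne p hp) h1
    exact ht.2 B htB.le

end Threshold

/-- In dimension at least two there are arbitrarily many unit vectors whose pairwise inner
products are bounded away from one, uniformly in the dimension. -/
theorem exists_unit_vectors (n : ℕ) {k : ℕ} (hk : 2 ≤ k) :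
    ∃ P : Fin n → Euc k, (∀ j, ‖P j‖ = 1) ∧
      ∀ j j', j ≠ j' → inner ℝ (P j) (P j') ≤ Real.cos (1 / (n + 1)) := by
  obtain ⟨T⟩ := exists_linearIsometry_of_le hk
  have hn : (0 : ℝ) < n + 1 := by positivity
  -- Angles at least `1 / (n + 1)` apart within an arc shorter than `1 < π`, where cosine decreases.
  let θ : Fin n → ℝ := fun j => (j : ℝ) / (n + 1)
  let V : Fin n → Euc 2 := fun j => !₂[Real.cos (θ j), Real.sin (θ j)]
  have hin : ∀ j j', inner ℝ (V j) (V j') = Real.cos (θ j - θ j') := fun j j' => by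
    rw [Real.cos_sub]
    simp [V, PiLp.inner_apply, Fin.sum_univ_two]
    ring
  refine ⟨fun j => T (V j), fun j => ?_, fun j j' hjj => ?_⟩
  · have h1 := hin j j
    rw [sub_self, Real.cos_zero, real_inner_self_eq_norm_sq] at h1
    rw [T.norm_map]
    exact (sq_eq_sq₀ (norm_nonneg _) zero_le_one).mp (by rw [h1, one_pow])
  · rw [T.inner_map_map, hin, ← Real.cos_abs]
    have h1 : |θ j - θ j'| = |(j : ℝ) - j'| / (n + 1) := by
      rw [← sub_div, abs_div, abs_of_pos hn]
    have h2 : (1 : ℝ) ≤ |(j : ℝ) - j'| := by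
      have h3 : (j : ℤ) - j' ≠ 0 := fun h => hjj (Fin.ext (by omega))
      have := Int.one_le_abs h3
      exact_mod_cast this
    have h4 : |(j : ℝ) - j'| ≤ n + 1 := by
      have hj : (j : ℝ) < n := by exact_mod_cast j.2
      have hj' : (j' : ℝ) < n := by exact_mod_cast j'.2
      have h0 : (0 : ℝ) ≤ j := by positivity
      have h0' : (0 : ℝ) ≤ j' := by positivity
      exact abs_le.mpr ⟨by linarith, by linarith⟩
    rw [h1]
    refine Real.cos_le_cos_of_nonneg_of_le_pi (by positivity) ?_ (by gcongr)
    have : |(j : ℝ) - j'| / (n + 1) ≤ 1 := (div_le_one hn).mpr h4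
    linarith [Real.pi_gt_three]

theorem one_sub_cos_one_div_pos (n : ℕ) : 0 < 1 - Real.cos (1 / (n + 1)) := by
  have h0 : (0 : ℝ) < 1 / (n + 1) := by positivity
  have h1 : (1 : ℝ) / (n + 1) ≤ 1 := by
    rw [div_le_one (by positivity)]; linarith [Nat.cast_nonneg (α := ℝ) n]
  have := Real.cos_lt_cos_of_nonneg_of_le_pi le_rfl (by linarith [Real.pi_gt_three]) h0
  rw [Real.cos_zero] at this
  linarith

/-- If `ψ` identifies the pairs in `S` of distinct points, and yet its loss is at most `ℓ 0` on
the diagonal and `y` off it, then `S` has a small measure. -/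
theorem measureReal_mul_le_of_integral_le {A E : Type*} [MeasurableSpace A] [MeasurableEq A]
    [NormedAddCommGroup E] [InnerProductSpace ℝ E] {ℓ : ℝ → ℝ} (hℓ : Continuous ℓ) {m : ℝ}
    (hm : ∀ x, m ≤ ℓ x) (μ : Measure A) [IsProbabilityMeasure μ] {B : ℝ} {ψ : A → E}
    (hψ : AEStronglyMeasurable ψ μ) (hψB : ∀ a, ‖ψ a‖ = B) {y : ℝ} (hy : m ≤ y)
    [DecidablePred fun q : A × A => q.1 = q.2]
    (hJ : ∫ q, ℓ (B ^ 2 - inner ℝ (ψ q.1) (ψ q.2)) ∂(μ.prod μ) ≤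
      ∫ q : A × A, (if q.1 = q.2 then ℓ 0 else y) ∂(μ.prod μ))
    {S : Set (A × A)} (hS : MeasurableSet S) (hSne : ∀ q ∈ S, q.1 ≠ q.2)
    (hSψ : ∀ᵐ q ∂(μ.prod μ), q ∈ S → ψ q.1 = ψ q.2) :
    (μ.prod μ).real S * (ℓ 0 - m) ≤ y - m := by
  have hd : MeasurableSet {q : A × A | q.1 = q.2} :=
    (measurableSet_diagonal : MeasurableSet (Set.diagonal A))
  let _ : DecidablePred (· ∈ {q : A × A | q.1 = q.2}) :=
    fun q => inferInstanceAs (Decidable (q.1 = q.2))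
  have hite : ∀ x : ℝ, Integrable (fun q : A × A => if q.1 = q.2 then ℓ 0 else x) (μ.prod μ) :=
    fun x => Integrable.piecewise (s := {q : A × A | q.1 = q.2}) (f := fun _ => ℓ 0)
      (g := fun _ => x) hd
      (integrable_const _).integrableOn (integrable_const _).integrableOn
  have hSi : Integrable (S.indicator fun _ => ℓ 0 - m) (μ.prod μ) :=
    (integrable_const _).indicator hS
  -- Pointwise lower bound for the loss of `ψ`: pairs in `S` are identified and cost `ℓ 0`, other
  -- distinct pairs at least `m`.
  have h1 : ∫ q : A × A, ((if q.1 = q.2 then ℓ 0 else m) + S.indicator (fun _ => ℓ 0 - m) q)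
      ∂(μ.prod μ) ≤ ∫ q : A × A, (if q.1 = q.2 then ℓ 0 else y) ∂(μ.prod μ) := by
    refine le_trans (integral_mono_ae ((hite m).add hSi)
      (integrable_loss hℓ hψ hψ fun a => (hψB a).le) ?_) hJ
    filter_upwards [hSψ] with q hq
    by_cases hqS : q ∈ S
    · simp only [if_neg (hSne q hqS), Set.indicator_of_mem hqS, hq hqS,
        inner_self_of_norm_eq (hψB _), sub_self]
      linarith
    · simp only [Set.indicator_of_notMem hqS, add_zero]
      split_ifs with h
      · rw [h, inner_self_of_norm_eq (hψB _), sub_self]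
      · exact hm _
  rw [integral_add (hite m) hSi, integral_indicator_const _ hS, smul_eq_mul] at h1
  have h2 : ∫ q : A × A, (if q.1 = q.2 then ℓ 0 else y) ∂(μ.prod μ) ≤
      ∫ q : A × A, ((if q.1 = q.2 then ℓ 0 else m) + (y - m)) ∂(μ.prod μ) := by
    refine integral_mono (hite y) ((hite m).add (integrable_const _)) fun q => ?_
    dsimp only
    split_ifs <;> linarith
  rw [integral_add (hite m) (integrable_const _)] at h2
  simp only [integral_const, probReal_univ, one_smul] at h2
  linarith

/-! ### Splitting vectors into invariant and spurious coordinates -/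

section Coordinates

variable {d : ℕ}

theorem measurable_coords (S : Finset (Fin d)) : Measurable (coords S) :=
  measurable_pi_lambda _ fun j => (EuclideanSpace.proj (𝕜 := ℝ) (j : Fin d)).measurable

/-- The vector with the coordinates `r` on `R` and `u` off `R`. -/
noncomputable def join (R : Finset (Fin d)) (p : (R → ℝ) × ((Rᶜ : Finset (Fin d)) → ℝ)) : Euc d :=
  WithLp.toLp 2 fun j =>
    if h : j ∈ R then p.1 ⟨j, h⟩ else p.2 ⟨j, Finset.mem_compl.mpr h⟩

theorem join_apply (R : Finset (Fin d)) (p : (R → ℝ) × ((Rᶜ : Finset (Fin d)) → ℝ)) (j : Fin d) :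
    join R p j = if h : j ∈ R then p.1 ⟨j, h⟩ else p.2 ⟨j, Finset.mem_compl.mpr h⟩ := rfl

theorem measurable_join (R : Finset (Fin d)) : Measurable (join R) := by
  refine (WithLp.measurable_toLp 2 _).comp (measurable_pi_lambda _ fun j => ?_)
  by_cases h : j ∈ R
  · simp only [dif_pos h]; fun_prop
  · simp only [dif_neg h]; fun_prop

@[simp] theorem coords_join (R : Finset (Fin d)) (p : (R → ℝ) × ((Rᶜ : Finset (Fin d)) → ℝ)) :
    coords R (join R p) = p.1 := by
  ext j; simp [coords, join_apply]

@[simp] theorem coords_compl_join (R : Finset (Fin d))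
    (p : (R → ℝ) × ((Rᶜ : Finset (Fin d)) → ℝ)) : coords Rᶜ (join R p) = p.2 := by
  ext j
  have := Finset.mem_compl.mp j.2
  simp [coords, join_apply, this]

@[simp] theorem join_coords (R : Finset (Fin d)) (z : Euc d) :
    join R (coords R z, coords Rᶜ z) = z := by
  ext j
  simp [join_apply, coords]

theorem glue_join (R : Finset (Fin d)) (p q : (R → ℝ) × ((Rᶜ : Finset (Fin d)) → ℝ)) :
    glue R (join R p) (join R q) = join R (p.1, q.2) := by
  ext j
  by_cases h : j ∈ R <;> simp [glue, join_apply, h]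

/-- Splitting a vector into its coordinates in and off `R`, in the inverse direction. -/
noncomputable def joinEquiv (R : Finset (Fin d)) :
    (R → ℝ) × ((Rᶜ : Finset (Fin d)) → ℝ) ≃ᵐ Euc d where
  toFun := join R
  invFun z := (coords R z, coords Rᶜ z)
  left_inv p := by simp
  right_inv z := by simp
  measurable_toFun := measurable_join R
  measurable_invFun := (measurable_coords R).prodMk (measurable_coords Rᶜ)

/-- Inserting a common spurious part removes those coordinates from the distance. This is what keeps
sections Lipschitz. -/
theorem dist_join_le (R : Finset (Fin d)) (z z' : Euc d) (u : (Rᶜ : Finset (Fin d)) → ℝ) :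
    dist (join R (coords R z, u)) (join R (coords R z', u)) ≤ dist z z' := by
  rw [EuclideanSpace.dist_eq, EuclideanSpace.dist_eq]
  refine Real.sqrt_le_sqrt (Finset.sum_le_sum fun j _ => ?_)
  by_cases h : j ∈ R
  · simp [join_apply, h, coords]
  · simp [join_apply, h]

end Coordinates

/-! ### The data model as a product law -/

namespace DataModel

variable {d : ℕ} {X : Type u} (M : DataModel d X)

instance : IsProbabilityMeasure M.D := M.isProb

/-- The law of the invariant part `z_R`. -/
noncomputable def invLaw : Measure (M.R → ℝ) := M.D.map (coords M.R)

/-- The law of the spurious part `z_U`. -/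
noncomputable def spurLaw : Measure ((M.Rᶜ : Finset (Fin d)) → ℝ) := M.D.map (coords M.Rᶜ)

instance : IsProbabilityMeasure M.invLaw :=
  Measure.isProbabilityMeasure_map (measurable_coords _).aemeasurable

instance : IsProbabilityMeasure M.spurLaw :=
  Measure.isProbabilityMeasure_map (measurable_coords _).aemeasurable

/-- The joint law of `z_R` and `z_U`. -/
noncomputable abbrev splitLaw : Measure ((M.R → ℝ) × ((M.Rᶜ : Finset (Fin d)) → ℝ)) :=
  M.invLaw.prod M.spurLaw

theorem measurePreserving_coords : MeasurePreserving (coords M.R) M.D M.invLaw :=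
  ⟨measurable_coords _, rfl⟩

theorem measurePreserving_split :
    MeasurePreserving (fun z => (coords M.R z, coords M.Rᶜ z)) M.D M.splitLaw :=
  ⟨(measurable_coords _).prodMk (measurable_coords _),
    M.indep.map_prod_eq_prod_map_map (measurable_coords _).aemeasurable
      (measurable_coords _).aemeasurable⟩

theorem measurePreserving_join : MeasurePreserving (join M.R) M.splitLaw M.D := by
  refine ⟨measurable_join _, ?_⟩
  rw [← M.measurePreserving_split.map_eq, Measure.map_map (measurable_join _)
    M.measurePreserving_split.measurable]
  simp [Function.comp_def]

/-- The expected loss of a function of `z_R` of norm `B`. -/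
noncomputable def invLoss (ℓ : ℝ → ℝ) (B : ℝ) {k : ℕ} (ψ : (M.R → ℝ) → Euc k) : ℝ :=
  ∫ q, ℓ (B ^ 2 - inner ℝ (ψ q.1) (ψ q.2)) ∂(M.invLaw.prod M.invLaw)

theorem contrastiveLoss_eq_integral_join (ℓ : ℝ → ℝ) {k : ℕ} (φ : X → Euc k) :
    M.contrastiveLoss ℓ φ = ∫ t, ℓ (inner ℝ (φ (M.g (join M.R t.1)))
      (φ (M.g (join M.R (t.1.1, t.2.1.2))) - φ (M.g (join M.R t.2.2))))
      ∂(M.splitLaw.prod (M.splitLaw.prod M.splitLaw)) := by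
  have hj := M.measurePreserving_join
  have he : MeasurableEmbedding (join M.R) := (joinEquiv M.R).measurableEmbedding
  have := (hj.prod (hj.prod hj)).integral_comp (he.prodMap (he.prodMap he))
    (fun t : Euc d × Euc d × Euc d =>
      ℓ (inner ℝ (φ (M.g t.1)) (φ (M.g (glue M.R t.1 t.2.1)) - φ (M.g t.2.2))))
  rw [contrastiveLoss, ← this]
  simp only [Prod.map_fst, Prod.map_snd, glue_join]

theorem contrastiveLoss_eq_of_ae_eq (ℓ : ℝ → ℝ) {k : ℕ} {φ : X → Euc k}
    {H : (M.R → ℝ) × ((M.Rᶜ : Finset (Fin d)) → ℝ) → Euc k}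
    (h : ∀ᵐ p ∂M.splitLaw, φ (M.g (join M.R p)) = H p) :
    M.contrastiveLoss ℓ φ = ∫ t, ℓ (inner ℝ (H t.1) (H (t.1.1, t.2.1.2) - H t.2.2))
      ∂(M.splitLaw.prod (M.splitLaw.prod M.splitLaw)) := by
  rw [contrastiveLoss_eq_integral_join]
  have h2 : MeasurePreserving (fun t : ((M.R → ℝ) × ((M.Rᶜ : Finset (Fin d)) → ℝ)) ×
      ((M.R → ℝ) × ((M.Rᶜ : Finset (Fin d)) → ℝ)) × ((M.R → ℝ) × ((M.Rᶜ : Finset (Fin d)) → ℝ)) =>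
      (t.1.1, t.2.1.2)) (M.splitLaw.prod (M.splitLaw.prod M.splitLaw)) M.splitLaw :=
    (measurePreserving_fst (μ := M.invLaw) (ν := M.spurLaw)).prod
      ((measurePreserving_snd (μ := M.invLaw) (ν := M.spurLaw)).comp
        (measurePreserving_fst (μ := M.splitLaw) (ν := M.splitLaw)))
  refine integral_congr_ae ?_
  filter_upwards [Measure.quasiMeasurePreserving_fst.ae h,
    Measure.quasiMeasurePreserving_snd.ae (Measure.quasiMeasurePreserving_snd.ae h),
    h2.quasiMeasurePreserving.ae h] with t h1 h3 h4
  rw [h1, h3, h4]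

theorem contrastiveLoss_eq_invLoss {ℓ : ℝ → ℝ} (hℓ : Continuous ℓ) {k : ℕ} {φ : X → Euc k}
    {B : ℝ} {ψ : (M.R → ℝ) → Euc k} (hψB : ∀ r, ‖ψ r‖ = B)
    (hψ : AEStronglyMeasurable ψ M.invLaw)
    (h : ∀ᵐ z ∂M.D, φ (M.g z) = ψ (coords M.R z)) :
    M.contrastiveLoss ℓ φ = M.invLoss ℓ B ψ := by
  have h1 := M.measurePreserving_join.quasiMeasurePreserving.ae h
  simp only [coords_join] at h1
  rw [M.contrastiveLoss_eq_of_ae_eq ℓ (H := fun p => ψ p.1) h1, invLoss]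
  have h2 : MeasurePreserving (fun t : ((M.R → ℝ) × ((M.Rᶜ : Finset (Fin d)) → ℝ)) ×
      ((M.R → ℝ) × ((M.Rᶜ : Finset (Fin d)) → ℝ)) × ((M.R → ℝ) × ((M.Rᶜ : Finset (Fin d)) → ℝ)) =>
      (t.1.1, t.2.2.1)) (M.splitLaw.prod (M.splitLaw.prod M.splitLaw))
      (M.invLaw.prod M.invLaw) :=
    (measurePreserving_fst (μ := M.invLaw) (ν := M.spurLaw)).prod
      ((measurePreserving_fst (μ := M.invLaw) (ν := M.spurLaw)).comp
        (measurePreserving_snd (μ := M.splitLaw) (ν := M.splitLaw)))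
  rw [← h2.integral_comp_of_aestronglyMeasurable (aestronglyMeasurable_loss hℓ B hψ hψ)]
  simp only [inner_sub_right, inner_self_of_norm_eq (hψB _)]

/-- `ψ`, seen as a function of `z`, is Lipschitz on each part of a finite partition of `Z`. -/
def IsInvRegular {k : ℕ} (ψ : (M.R → ℝ) → Euc k) : Prop :=
  ∃ (L : NNReal) (κ : Type) (_ : Finite κ) (c : Euc d → κ),
    ∀ j, LipschitzOnWith L (fun z => ψ (coords M.R z)) {z | z ∈ M.Z ∧ c z = j}

/-- Functions of `z_R` that come from representations of norm `B`. -/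
structure IsInvRepresentation (B : ℝ) {k : ℕ} (ψ : (M.R → ℝ) → Euc k) : Prop where
  norm_eq : ∀ r, ‖ψ r‖ = B
  measurable : AEStronglyMeasurable ψ M.invLaw
  regular : M.IsInvRegular ψ

variable {M}

theorem IsInvRepresentation.exists_representation (hrec : M.Recoverable) {ℓ : ℝ → ℝ}
    (hℓ : Continuous ℓ) {B : ℝ} {k : ℕ} {ψ : (M.R → ℝ) → Euc k}
    (hψ : M.IsInvRepresentation B ψ) :
    ∃ φ : X → Euc k, M.IsRepresentation B φ ∧ M.contrastiveLoss ℓ φ = M.invLoss ℓ B ψ := by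
  classical
  -- By (A1), `z_R` is a function of `x` on the image of `Z`; elsewhere any value of norm `B`
  -- serves.
  let φ : X → Euc k := fun x =>
    if hx : ∃ z ∈ M.Z, M.g z = x then ψ (coords M.R hx.choose) else ψ 0
  have hφ : ∀ z ∈ M.Z, φ (M.g z) = ψ (coords M.R z) := fun z hz => by
    have hx : ∃ z' ∈ M.Z, M.g z' = M.g z := ⟨z, hz, rfl⟩
    simp only [φ, dif_pos hx]
    rw [hrec _ hx.choose_spec.1 z hz hx.choose_spec.2]
  have hae : ∀ᵐ z ∂M.D, φ (M.g z) = ψ (coords M.R z) := M.mem_Z.mono hφ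
  refine ⟨φ, ⟨fun x => ?_, ?_, ?_⟩, M.contrastiveLoss_eq_invLoss hℓ hψ.norm_eq hψ.measurable hae⟩
  · by_cases hx : ∃ z ∈ M.Z, M.g z = x
    · simp only [φ, dif_pos hx, hψ.norm_eq]
    · simp only [φ, dif_neg hx, hψ.norm_eq]
  · obtain ⟨L, κ, _, c, hc⟩ := hψ.regular
    obtain ⟨n, ⟨e⟩⟩ := Finite.exists_equiv_fin κ
    refine ⟨L, n, fun z => e (c z), fun j => ?_⟩
    have h1 := hc (e.symm j)
    intro z hz z' hz'
    have h2 := h1 ⟨hz.1, by rw [← hz.2, e.symm_apply_apply]⟩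
      ⟨hz'.1, by rw [← hz'.2, e.symm_apply_apply]⟩
    simp only [hφ z hz.1, hφ z' hz'.1]
    exact h2
  · exact (hψ.measurable.comp_measurePreserving M.measurePreserving_coords).congr
      (hae.mono fun z hz => hz.symm)

end DataModel

/-! ### Optimal representations as functions of the invariant part -/

namespace DataModel

variable {d : ℕ} {X : Type u} {M : DataModel d X}

theorem ae_coords_of_ae_invLaw {p : (M.R → ℝ) → Prop} (h : ∀ᵐ r ∂M.invLaw, p r) :
    ∀ᵐ z ∂M.D, p (coords M.R z) :=
  M.measurePreserving_coords.quasiMeasurePreserving.ae h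

theorem ae_invLaw_mem {s : Set (M.R → ℝ)} (hs : MeasurableSet s)
    (h : ∀ᵐ z ∂M.D, coords M.R z ∈ s) : ∀ᵐ r ∂M.invLaw, r ∈ s :=
  (ae_map_iff (measurable_coords _).aemeasurable hs).mpr h

theorem invLaw_singleton_ne_one (h : ¬ M.InvariantPartConstant) (r : M.R → ℝ) : M.invLaw {r} ≠ 1 := by
  intro h1
  refine h ⟨r, ae_coords_of_ae_invLaw (p := fun r' => r' = r) ?_⟩
  exact (prob_compl_eq_zero_iff (measurableSet_singleton r)).mpr h1

open Classical in
/-- The section of `φ ∘ g` obtained by inserting `s r` for the spurious part; vectors outside `Z`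
are avoided. -/
noncomputable def sectionOf (M : DataModel d X) {k : ℕ} (φ : X → Euc k)
    (s : (M.R → ℝ) → (M.Rᶜ : Finset (Fin d)) → ℝ) (r : M.R → ℝ) : Euc k :=
  if join M.R (r, s r) ∈ M.Z then φ (M.g (join M.R (r, s r))) else φ (M.g 0)

/-- On a part where the cell of `z_R` is fixed, the completed vector `J z` moves no more than `z`.
It then suffices to split further by the colour of `J z` and by its membership in `Z`. -/
theorem IsRepresentation.isInvRegular_sectionOf {B : ℝ} {k : ℕ} {φ : X → Euc k}
    (hφ : M.IsRepresentation B φ) {κ : Type} [Finite κ] (c : (M.R → ℝ) → κ)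
    (u : κ → (M.Rᶜ : Finset (Fin d)) → ℝ) :
    M.IsInvRegular (M.sectionOf φ fun r => u (c r)) := by
  classical
  obtain ⟨L, n, c₀, hc₀⟩ := hφ.regular
  let J : Euc d → Euc d := fun z => join M.R (coords M.R z, u (c (coords M.R z)))
  refine ⟨L, κ × Fin n × Bool, inferInstance,
    fun z => (c (coords M.R z), c₀ (J z), decide (J z ∈ M.Z)), ?_⟩
  rintro ⟨a, j, b⟩ z ⟨-, hz⟩ z' ⟨-, hz'⟩
  simp only [Prod.mk.injEq] at hz hz'
  by_cases hJ : J z ∈ M.Z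
  · have hJ' : J z' ∈ M.Z := by
      have := hz.2.2.trans hz'.2.2.symm
      simpa [hJ] using this
    simp only [sectionOf]
    rw [if_pos hJ, if_pos hJ']
    refine (hc₀ j ⟨hJ, hz.2.1⟩ ⟨hJ', hz'.2.1⟩).trans ?_
    gcongr
    simp only [J, hz.1, hz'.1]
    rw [edist_dist, edist_dist]
    exact ENNReal.ofReal_le_ofReal (dist_join_le _ _ _ _)
  · have hJ' : J z' ∉ M.Z := by
      have := hz.2.2.trans hz'.2.2.symm
      simpa [hJ] using this
    simp only [sectionOf]
    rw [if_neg hJ, if_neg hJ', edist_self]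
    exact zero_le

theorem IsRepresentation.norm_sectionOf {B : ℝ} {k : ℕ} {φ : X → Euc k}
    (hφ : M.IsRepresentation B φ) (s : (M.R → ℝ) → (M.Rᶜ : Finset (Fin d)) → ℝ) (r : M.R → ℝ) :
    ‖M.sectionOf φ s r‖ = B := by
  unfold sectionOf
  split_ifs <;> exact hφ.norm_eq _

/-- `φ ∘ g` agrees almost everywhere with a measurable function of norm `B`. -/
theorem IsRepresentation.exists_measurable {B : ℝ} {k : ℕ} {φ : X → Euc k}
    (hφ : M.IsRepresentation B φ) :
    ∃ H : (M.R → ℝ) × ((M.Rᶜ : Finset (Fin d)) → ℝ) → Euc k, Measurable H ∧ (∀ p, ‖H p‖ = B) ∧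
      ∀ᵐ p ∂M.splitLaw, φ (M.g (join M.R p)) = H p := by
  classical
  have h := hφ.measurable.comp_measurePreserving M.measurePreserving_join
  have hmk : Measurable (h.mk _) := h.stronglyMeasurable_mk.measurable
  refine ⟨fun p => if ‖h.mk _ p‖ = B then h.mk _ p else φ (M.g 0), ?_, fun p => ?_, ?_⟩
  · exact Measurable.ite (measurableSet_eq_fun hmk.norm measurable_const) hmk measurable_const
  · dsimp only
    split_ifs with h1
    · exact h1
    · exact hφ.norm_eq _
  · filter_upwards [h.ae_eq_mk] with p hp
    rw [← hp, if_pos]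
    · rfl
    · exact hφ.norm_eq _

/-- An optimal representation is almost surely a function of the invariant part. -/
theorem IsOptimal.exists_isInvRepresentation {ℓ : ℝ → ℝ} (hconv : ConvexOn ℝ Set.univ ℓ)
    (hdec : StrictAnti ℓ) (hbdd : BddBelow (Set.range ℓ)) (hrec : M.Recoverable)
    (hconst : ¬ M.InvariantPartConstant) {K : Set ℕ} {B : ℝ} {k : ℕ} {φ : X → Euc k}
    (hopt : M.IsOptimal ℓ K B φ) :
    ∃ ψ : (M.R → ℝ) → Euc k, M.IsInvRepresentation B ψ ∧
      ∀ᵐ z ∂M.D, φ (M.g z) = ψ (coords M.R z) := by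
  obtain ⟨hk, hφ, hmin⟩ := hopt
  have hℓ := hconv.continuous_of_univ
  obtain ⟨H, hH, hHB, hφH⟩ := hφ.exists_measurable
  let good : (M.R → ℝ) → ((M.Rᶜ : Finset (Fin d)) → ℝ) → Prop := fun r u =>
    join M.R (r, u) ∈ M.Z ∧ φ (M.g (join M.R (r, u))) = H (r, u)
  have hgood : ∀ᵐ p ∂M.splitLaw, good p.1 p.2 :=
    (M.measurePreserving_join.quasiMeasurePreserving.ae M.mem_Z).and hφH
  have hgood' : ∀ᵐ u ∂M.spurLaw, ∀ᵐ r ∂M.invLaw, good r u :=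
    Measure.ae_ae_of_ae_prod (Measure.measurePreserving_swap.quasiMeasurePreserving.ae hgood)
  have hsec : ∀ {κ : Type} [Finite κ] (c : (M.R → ℝ) → κ) (u : κ → (M.Rᶜ : Finset (Fin d)) → ℝ),
      (∀ a, ∀ᵐ r ∂M.invLaw, good r (u a)) →
      ∀ᵐ r ∂M.invLaw, M.sectionOf φ (fun r => u (c r)) r = H (r, u (c r)) := by
    intro κ _ c u hu
    filter_upwards [ae_all_iff.mpr hu] with r hr
    have h1 := hr (c r)
    simp only [sectionOf]
    rw [if_pos h1.1, h1.2]
  have hrep : ∀ {κ : Type} [Finite κ] [MeasurableSpace κ] [DiscreteMeasurableSpace κ]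
      (c : (M.R → ℝ) → κ) (_ : Measurable c) (u : κ → (M.Rᶜ : Finset (Fin d)) → ℝ),
      (∀ a, ∀ᵐ r ∂M.invLaw, good r (u a)) →
      M.IsInvRepresentation B (M.sectionOf φ fun r => u (c r)) := by
    intro κ _ _ _ c hc u hu
    refine ⟨hφ.norm_sectionOf _, ?_, hφ.isInvRegular_sectionOf c u⟩
    have h1 : Measurable fun r => H (r, u (c r)) :=
      hH.comp (measurable_id.prodMk ((Measurable.of_discrete (f := u)).comp hc))
    exact h1.aestronglyMeasurable.congr ((hsec c u hu).mono fun r hr => hr.symm)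
  have hdep : ∀ᵐ r ∂M.invLaw, ∀ᵐ w ∂(M.spurLaw.prod M.spurLaw), H (r, w.1) = H (r, w.2) := by
    by_contra hne
    obtain ⟨n, c, u, hc, hu, hlt⟩ := exists_section_integral_lt hconv hdec
      (fun x => ciInf_le hbdd x) M.invLaw M.spurLaw hH hHB (invLaw_singleton_ne_one hconst) hne
      (ae_iff.mp hgood')
    have hu' : ∀ a, ∀ᵐ r ∂M.invLaw, good r (u a) := fun a => not_not.mp (hu a)
    obtain ⟨φ', hφ', hloss⟩ := (hrep c hc u hu').exists_representation hrec hℓ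
    refine absurd (hmin k hk φ' hφ') (not_le.mpr ?_)
    rw [hloss, M.contrastiveLoss_eq_of_ae_eq ℓ hφH, invLoss]
    refine lt_of_eq_of_lt (integral_congr_ae ?_) hlt
    filter_upwards [Measure.quasiMeasurePreserving_fst.ae (hsec c u hu'),
      Measure.quasiMeasurePreserving_snd.ae (hsec c u hu')] with q h1 h2
    rw [h1, h2]
  have hms : MeasurableSet {p : (M.R → ℝ) × ((M.Rᶜ : Finset (Fin d)) → ℝ) ×
      ((M.Rᶜ : Finset (Fin d)) → ℝ) | H (p.1, p.2.1) = H (p.1, p.2.2)} :=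
    measurableSet_eq_fun (by fun_prop) (by fun_prop)
  -- Almost every second spurious value can be frozen: some `u₀` has `H (r, u) = H (r, u₀)` for
  -- almost all `(r, u)`.
  have h1 := (Measure.ae_prod_iff_ae_ae hms).mpr hdep
  have h2 := (measurePreserving_prodAssoc M.invLaw M.spurLaw M.spurLaw).quasiMeasurePreserving.ae h1
  have h3 := Measure.ae_ae_of_ae_prod
    (Measure.measurePreserving_swap.quasiMeasurePreserving.ae h2)
  obtain ⟨u₀, hu₀, hu₀'⟩ := (h3.and hgood').exists
  have hu : ∀ _ : Unit, ∀ᵐ r ∂M.invLaw, good r u₀ := fun _ => hu₀'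
  refine ⟨M.sectionOf φ fun _ => u₀, hrep (fun _ => ()) measurable_const (fun _ => u₀) hu, ?_⟩
  have h4 : ∀ᵐ p ∂M.splitLaw, φ (M.g (join M.R p)) = M.sectionOf φ (fun _ => u₀) p.1 := by
    filter_upwards [hu₀, hφH,
      Measure.quasiMeasurePreserving_fst.ae (hsec (fun _ => ()) (fun _ => u₀) hu)] with p h5 h6 h7
    rw [h6, h7]
    exact h5
  have h5 := M.measurePreserving_split.quasiMeasurePreserving.ae h4
  simpa only [join_coords] using h5

theorem IsOptimal.invLoss_le {ℓ : ℝ → ℝ} (hℓ : Continuous ℓ) (hrec : M.Recoverable) {K : Set ℕ}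
    {B : ℝ} {k : ℕ} {φ : X → Euc k} (hopt : M.IsOptimal ℓ K B φ) {ψ : (M.R → ℝ) → Euc k}
    (hψ : M.IsInvRepresentation B ψ) (hφψ : ∀ᵐ z ∂M.D, φ (M.g z) = ψ (coords M.R z))
    {k' : ℕ} (hk' : k' ∈ K) {ψ' : (M.R → ℝ) → Euc k'} (hψ' : M.IsInvRepresentation B ψ') :
    M.invLoss ℓ B ψ ≤ M.invLoss ℓ B ψ' := by
  obtain ⟨φ', hφ', hloss⟩ := hψ'.exists_representation hrec hℓ
  rw [← hloss, ← M.contrastiveLoss_eq_invLoss hℓ hψ.norm_eq hψ.measurable hφψ]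
  exact hopt.2.2 k' hk' φ' hφ'

/-- When the output dimension is unbounded, an optimal representation cannot be improved by
vectors of smaller norm, even if the pairs of equal points are disregarded. -/
theorem IsOptimal.invLoss_le_relaxedLoss {ℓ : ℝ → ℝ} (hℓ : Continuous ℓ) (hdec : StrictAnti ℓ)
    (hbdd : BddBelow (Set.range ℓ)) (hrec : M.Recoverable) {K : Set ℕ} (hK : ¬ BddAbove K)
    {B : ℝ} (hB : 0 ≤ B) {k : ℕ} {φ : X → Euc k} (hopt : M.IsOptimal ℓ K B φ)
    {ψ : (M.R → ℝ) → Euc k} (hψ : M.IsInvRepresentation B ψ)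
    (hφψ : ∀ᵐ z ∂M.D, φ (M.g z) = ψ (coords M.R z)) {S : Set (M.R → ℝ)} (hS : MeasurableSet S)
    [DecidablePred (· ∈ S)] {w : Euc k} (hw : ‖w‖ ≤ B) :
    M.invLoss ℓ B ψ ≤
      ∫ q, relaxedLoss ℓ B (S.piecewise (fun _ => w) ψ) q ∂(M.invLaw.prod M.invLaw) := by
  set v : (M.R → ℝ) → Euc k := S.piecewise (fun _ => w) ψ
  have hvS : ∀ a ∈ S, v a = w := fun a ha => Set.piecewise_eq_of_mem _ _ _ ha
  have hvS' : ∀ a ∉ S, v a = ψ a := fun a ha => Set.piecewise_eq_of_notMem _ _ _ ha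
  have hvB : ∀ a, ‖v a‖ ≤ B := fun a => by
    by_cases ha : a ∈ S
    · rw [hvS a ha]; exact hw
    · rw [hvS' a ha]; exact (hψ.norm_eq a).le
  have hvm : AEStronglyMeasurable v M.invLaw :=
    AEStronglyMeasurable.piecewise hS aestronglyMeasurable_const hψ.measurable.restrict
  refine le_of_forall_pos_le_add fun ε hε => ?_
  obtain ⟨n, c, hc, h⟩ := exists_integral_lt_relaxedLoss hℓ hdec (fun x => ciInf_le hbdd x)
    M.invLaw hB hvm hvB hε
  obtain ⟨k', hk'K, hk'⟩ := not_bddAbove_iff.mp hK (k + Fintype.card (Fin n → Bool))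
  obtain ⟨T, e, hnorm, hmeas, hlt⟩ := h k' hk'.le
  refine (hopt.invLoss_le hℓ hrec hψ hφψ hk'K ⟨hnorm, hmeas, ?_⟩).trans hlt.le
  obtain ⟨L, κ, _, c₀, hc₀⟩ := hψ.regular
  -- On `S` within a cell the completed map is constant. Off `S` the norm is already `B`, so the
  -- added component vanishes and `T ∘ ψ` remains.
  refine ⟨L, κ × (Fin n → Bool) × Bool, inferInstance,
    fun z => (c₀ z, c (coords M.R z), decide (coords M.R z ∈ S)), ?_⟩
  rintro ⟨a, j, b⟩ z ⟨hzZ, hz⟩ z' ⟨hzZ', hz'⟩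
  simp only [Prod.mk.injEq] at hz hz'
  have hdd := hz.2.2.trans hz'.2.2.symm
  by_cases hzS : coords M.R z ∈ S
  · have hzS' : coords M.R z' ∈ S := by simpa [hzS] using hdd
    simp only [hvS _ hzS, hvS _ hzS', hz.2.1, hz'.2.1, edist_self]
    exact zero_le
  · have hzS' : coords M.R z' ∉ S := by simpa [hzS] using hdd
    simp only [hvS' _ hzS, hvS' _ hzS', hψ.norm_eq, sub_self, Real.sqrt_zero, zero_smul, add_zero]
    rw [T.isometry.edist_eq]
    exact hc₀ a ⟨hzZ, hz.1⟩ ⟨hzZ', hz'.1⟩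

/-! ### Features that are not encoded -/

/-- The pairs of invariant parts that differ exactly in the coordinate `i`. -/
def differAt (M : DataModel d X) (i : M.R) : Set ((M.R → ℝ) × (M.R → ℝ)) :=
  {q | (∀ j, j ≠ i → q.1 j = q.2 j) ∧ q.1 i ≠ q.2 i}

theorem measurableSet_differAt (i : M.R) : MeasurableSet (M.differAt i) := by
  have h1 : ∀ j : M.R, MeasurableSet {q : (M.R → ℝ) × (M.R → ℝ) | q.1 j = q.2 j} := fun j =>
    measurableSet_eq_fun (by fun_prop) (by fun_prop)
  have h2 : M.differAt i = (⋂ j, ⋂ _ : j ≠ i, {q | q.1 j = q.2 j}) ∩ {q | q.1 i = q.2 i}ᶜ := by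
    ext q; simp [differAt]
  rw [h2]
  exact (MeasurableSet.iInter fun j => MeasurableSet.iInter fun _ => h1 j).inter (h1 i).compl

theorem spread_eq {i : Fin d} (hi : i ∈ M.R) :
    M.spread i = (M.invLaw.prod M.invLaw).real (M.differAt ⟨i, hi⟩) := by
  have h := (M.measurePreserving_coords.prod M.measurePreserving_coords).measureReal_preimage
    (measurableSet_differAt (M := M) ⟨i, hi⟩).nullMeasurableSet
  rw [← h, spread]
  congr 1
  ext q
  simp [differAt, coords]

/-- If a function of `z_R` is independent of `z_i`, then it identifies almost all pairs that
differ in the coordinate `i` only. -/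
theorem ae_eq_of_independentOf {k : ℕ} {h : Euc d → Euc k} {ψ : (M.R → ℝ) → Euc k}
    (hψ : ∀ᵐ z ∂M.D, h z = ψ (coords M.R z)) {i : Fin d} (hi : i ∈ M.R)
    (hind : IndependentOf M.D {i} h) :
    ∀ᵐ q ∂(M.invLaw.prod M.invLaw), q ∈ M.differAt ⟨i, hi⟩ → ψ q.1 = ψ q.2 := by
  obtain ⟨f, hf⟩ := hind
  have h1 : ∀ᵐ z ∂M.D, ψ (coords M.R z) = f (coords {i}ᶜ z) := by
    filter_upwards [hψ, hf] with z h2 h3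
    rw [← h2, h3]
  have h2 := M.measurePreserving_join.quasiMeasurePreserving.ae h1
  simp only [coords_join] at h2
  have h3 := Measure.ae_ae_of_ae_prod (Measure.measurePreserving_swap.quasiMeasurePreserving.ae h2)
  -- One common spurious value `u` is fixed, so that two invariant parts equal off `i` give `f` the
  -- same argument.
  obtain ⟨u, hu⟩ := h3.exists
  simp only [Prod.swap_prod_mk] at hu
  filter_upwards [Measure.quasiMeasurePreserving_fst.ae hu,
    Measure.quasiMeasurePreserving_snd.ae hu] with q h4 h5 hq
  rw [h4, h5]
  congr 1
  ext j
  have hj : (j : Fin d) ≠ i := Finset.notMem_singleton.mp (Finset.mem_compl.mp j.2)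
  by_cases hjR : (j : Fin d) ∈ M.R
  · simp only [coords, join_apply, dif_pos hjR]
    exact hq.1 ⟨j, hjR⟩ fun h => hj (congrArg Subtype.val h)
  · simp [coords, join_apply, hjR]

/-- For a discrete invariant part, a feature without spread is a function of the others. -/
theorem independentOf_of_spread_eq_zero {C : Set (M.R → ℝ)} (hC : C.Countable)
    (hCae : ∀ᵐ z ∂M.D, coords M.R z ∈ C) {i : Fin d} (hi : i ∈ M.R) (h0 : M.spread i = 0)
    {Y : Type*} (f : Euc d → Y) : IndependentOf M.D {i} f := by
  classical
  let C' : Set (M.R → ℝ) := {r | M.invLaw {r} ≠ 0}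
  have hC' : ∀ᵐ z ∂M.D, coords M.R z ∈ C' := by
    have h1 : M.invLaw (C \ C') = 0 := by
      rw [← Set.biUnion_of_singleton (C \ C')]
      refine (measure_biUnion_null_iff (hC.mono Set.sdiff_subset)).mpr fun r hr => ?_
      exact not_not.mp hr.2
    have h2 : ∀ᵐ r ∂M.invLaw, r ∉ C \ C' := measure_eq_zero_iff_ae_notMem.mp h1
    filter_upwards [hCae, ae_coords_of_ae_invLaw h2] with z h3 h4
    by_contra h5
    exact h4 ⟨h3, h5⟩
  -- Two atoms differing only at `i` would form a pair of positive mass counted by the spread. Hence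
  -- the other coordinates determine the atom, and `fill` restores `z_i` from them; its default `0`
  -- matters only on a null set.
  have huniq : ∀ r ∈ C', ∀ r' ∈ C', (∀ j : M.R, j ≠ ⟨i, hi⟩ → r j = r' j) →
      r ⟨i, hi⟩ = r' ⟨i, hi⟩ := by
    intro r hr r' hr' hrr
    by_contra hne
    rw [spread_eq hi, measureReal_eq_zero_iff] at h0
    have h1 : (M.invLaw.prod M.invLaw) ({r} ×ˢ {r'}) = 0 := by
      refine measure_mono_null ?_ h0
      rintro ⟨a, b⟩ ⟨rfl, rfl⟩
      exact ⟨hrr, hne⟩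
    rw [Measure.prod_prod, mul_eq_zero] at h1
    exact h1.elim hr hr'
  let match_ : ((({i} : Finset (Fin d))ᶜ : Finset (Fin d)) → ℝ) → (M.R → ℝ) → Prop := fun y r =>
    r ∈ C' ∧ ∀ (j : M.R) (hj : j ≠ ⟨i, hi⟩),
      r j = y ⟨j, by simpa using fun h => hj (Subtype.ext h)⟩
  let fill : ((({i} : Finset (Fin d))ᶜ : Finset (Fin d)) → ℝ) → Euc d := fun y =>
    WithLp.toLp 2 fun j => if hj : j = i then
      (if hr : ∃ r, match_ y r then hr.choose ⟨i, hi⟩ else 0) else y ⟨j, by simpa using hj⟩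
  refine ⟨fun y => f (fill y), ?_⟩
  filter_upwards [hC'] with z hz
  congr 1
  ext j
  by_cases hj : j = i
  · have hr : ∃ r, match_ (coords {i}ᶜ z) r := ⟨coords M.R z, hz, fun _ _ => rfl⟩
    subst hj
    simp only [fill, dif_pos, dif_pos hr]
    exact huniq _ hz _ hr.choose_spec.1 fun j' hj' => (hr.choose_spec.2 j' hj').symm
  · simp [fill, dif_neg hj, coords]

theorem not_invariantPartConstant_of_spread_pos {i : Fin d} (hi : i ∈ M.R) (h : 0 < M.spread i) :
    ¬ M.InvariantPartConstant := by
  rintro ⟨c, hc⟩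
  refine h.ne' ?_
  have h1 : ∀ᵐ r ∂M.invLaw, r = c :=
    ae_invLaw_mem (measurableSet_singleton c) hc
  rw [spread_eq hi, measureReal_eq_zero_iff, measure_eq_zero_iff_ae_notMem]
  filter_upwards [Measure.quasiMeasurePreserving_fst.ae h1,
    Measure.quasiMeasurePreserving_snd.ae h1] with q h2 h3 h4
  exact h4.2 (by rw [h2, h3])

theorem ne_of_mem_differAt {i : M.R} {q : (M.R → ℝ) × (M.R → ℝ)} (hq : q ∈ M.differAt i) :
    q.1 ≠ q.2 := fun h => hq.2 (by rw [h])

/-- With unbounded output dimension, the spread of a feature that is not encoded is small. -/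
theorem IsOptimal.spread_mul_le {ℓ : ℝ → ℝ} (hconv : ConvexOn ℝ Set.univ ℓ)
    (hdec : StrictAnti ℓ) (hbdd : BddBelow (Set.range ℓ)) (hrec : M.Recoverable) {K : Set ℕ}
    (hK : ¬ BddAbove K) {B : ℝ} (hB : 0 ≤ B) {k : ℕ} {φ : X → Euc k}
    (hopt : M.IsOptimal ℓ K B φ) {i : Fin d} (hi : i ∈ M.R) (hpos : 0 < M.spread i)
    (hind : IndependentOf M.D {i} fun z => φ (M.g z)) :
    M.spread i * (ℓ 0 - ⨅ y, ℓ y) ≤ ℓ (B ^ 2) - ⨅ y, ℓ y := by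
  classical
  have hℓ := hconv.continuous_of_univ
  obtain ⟨ψ, hψ, hφψ⟩ := hopt.exists_isInvRepresentation hconv hdec hbdd hrec
    (not_invariantPartConstant_of_spread_pos hi hpos)
  rw [spread_eq hi]
  refine measureReal_mul_le_of_integral_le hℓ (fun x => ciInf_le hbdd x) M.invLaw hψ.measurable
    hψ.norm_eq (ciInf_le hbdd _) ?_ (measurableSet_differAt _) (fun q hq => ne_of_mem_differAt hq)
    (ae_eq_of_independentOf hφψ hi hind)
  have h1 := hopt.invLoss_le_relaxedLoss hℓ hdec hbdd hrec hK hB hψ hφψ MeasurableSet.univ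
    (w := 0) (by simpa)
  rw [invLoss] at h1
  refine h1.trans (le_of_eq (integral_congr_ae (ae_of_all _ fun q => ?_)))
  simp [relaxedLoss]

/-- With finitely many values of `z_R` and output dimension at least two, the spread of a feature
that is not encoded is small. -/
theorem IsOptimal.spread_mul_le_of_finite {ℓ : ℝ → ℝ} (hconv : ConvexOn ℝ Set.univ ℓ)
    (hdec : StrictAnti ℓ) (hbdd : BddBelow (Set.range ℓ)) (hrec : M.Recoverable) {n : ℕ}
    (hfin : (coords M.R '' M.Z).Finite) (hn : (coords M.R '' M.Z).ncard ≤ n) {K : Set ℕ}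
    {k' : ℕ} (hk'K : k' ∈ K) (hk' : 2 ≤ k') {B : ℝ} (hB : 0 ≤ B) {k : ℕ} {φ : X → Euc k}
    (hopt : M.IsOptimal ℓ K B φ) {i : Fin d} (hi : i ∈ M.R) (hpos : 0 < M.spread i)
    (hind : IndependentOf M.D {i} fun z => φ (M.g z)) :
    M.spread i * (ℓ 0 - ⨅ y, ℓ y) ≤
      ℓ ((1 - Real.cos (1 / (n + 1))) * B ^ 2) - ⨅ y, ℓ y := by
  classical
  have hℓ := hconv.continuous_of_univ
  obtain ⟨ψ, hψ, hφψ⟩ := hopt.exists_isInvRepresentation hconv hdec hbdd hrec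
    (not_invariantPartConstant_of_spread_pos hi hpos)
  rw [spread_eq hi]
  refine measureReal_mul_le_of_integral_le hℓ (fun x => ciInf_le hbdd x) M.invLaw hψ.measurable
    hψ.norm_eq (ciInf_le hbdd _) ?_ (measurableSet_differAt _) (fun q hq => ne_of_mem_differAt hq)
    (ae_eq_of_independentOf hφψ hi hind)
  set F := coords M.R '' M.Z
  have hF : ∀ᵐ r ∂M.invLaw, r ∈ F :=
    ae_invLaw_mem hfin.measurableSet (M.mem_Z.mono fun z hz => ⟨z, hz, rfl⟩)
  obtain ⟨r₀, hr₀⟩ := hF.exists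
  have := hfin.fintype
  obtain ⟨ι⟩ : Nonempty (F ↪ Fin n) := Function.Embedding.nonempty_of_card_le (by
    rwa [Fintype.card_fin, ← Nat.card_eq_fintype_card, Nat.card_coe_set_eq])
  let c : (M.R → ℝ) → Fin n := fun r => if h : r ∈ F then ι ⟨r, h⟩ else ι ⟨r₀, hr₀⟩
  have hcF : ∀ r ∈ F, ∀ r' ∈ F, r ≠ r' → c r ≠ c r' := fun r hr r' hr' hne h => by
    simp only [c, dif_pos hr, dif_pos hr'] at h
    exact hne (congrArg Subtype.val (ι.injective h))
  have hc : Measurable c := by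
    refine (measurable_const (a := ι ⟨r₀, hr₀⟩)).measurable_of_countable_ne
      (hfin.countable.mono fun r hr => ?_)
    by_contra h
    exact hr (by simp only [c, dif_neg h])
  obtain ⟨P, hP, hPP⟩ := exists_unit_vectors n hk'
  -- The competitor places the values of `z_R` at separated points of a circle of radius `B`. It is
  -- constant on each colour class, so the Lipschitz constant is `0`.
  have hψ' : M.IsInvRepresentation B fun r => B • P (c r) := by
    refine ⟨fun r => ?_, ?_, 0, Fin n, inferInstance, fun z => c (coords M.R z), ?_⟩
    · rw [norm_smul, hP, mul_one, Real.norm_of_nonneg hB]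
    · exact ((measurable_of_finite fun j => B • P j).comp hc).aestronglyMeasurable
    · rintro j z ⟨-, hz⟩ z' ⟨-, hz'⟩
      dsimp only at hz hz' ⊢
      rw [hz, hz', edist_self]
      exact zero_le
  refine (hopt.invLoss_le hℓ hrec hψ hφψ hk'K hψ').trans ?_
  have hd : MeasurableSet {q : (M.R → ℝ) × (M.R → ℝ) | q.1 = q.2} :=
    (measurableSet_diagonal : MeasurableSet (Set.diagonal (M.R → ℝ)))
  refine integral_mono_ae
    (integrable_loss hℓ hψ'.measurable hψ'.measurable fun r => (hψ'.norm_eq r).le)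
    (Integrable.piecewise (s := {q : (M.R → ℝ) × (M.R → ℝ) | q.1 = q.2}) (f := fun _ => ℓ 0)
      hd (integrable_const _).integrableOn (integrable_const _).integrableOn) ?_
  filter_upwards [Measure.quasiMeasurePreserving_fst.ae hF,
    Measure.quasiMeasurePreserving_snd.ae hF] with q h1 h2
  split_ifs with h
  · have h3 : q.1 = q.2 := h
    rw [h3, inner_self_of_norm_eq (hψ'.norm_eq q.2), sub_self]
  · refine hdec.antitone ?_
    have h3 := hPP _ _ (hcF _ h1 _ h2 h)
    rw [inner_smul_left, inner_smul_right]
    simp only [conj_trivial]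
    nlinarith [mul_le_mul_of_nonneg_left h3 (sq_nonneg B)]

/-- With unbounded output dimension and a nonatomic part of the law of `z_R`, representations of
large norm are never optimal. -/
theorem exists_forall_not_isOptimal {ℓ : ℝ → ℝ} (hconv : ConvexOn ℝ Set.univ ℓ)
    (hdec : StrictAnti ℓ) (hbdd : BddBelow (Set.range ℓ)) (hrec : M.Recoverable) {K : Set ℕ}
    (hK : ¬ BddAbove K) (hpos : M.invLaw {r | M.invLaw {r} = 0} ≠ 0) :
    ∃ b : ℝ, 0 < b ∧ ∀ B, b ≤ B → ∀ (k : ℕ) (φ : X → Euc k), ¬ M.IsOptimal ℓ K B φ := by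
  classical
  have hℓ := hconv.continuous_of_univ
  have hc : 0 < M.invLaw.real {r | M.invLaw {r} = 0} :=
    ENNReal.toReal_pos hpos (measure_ne_top _ _)
  have hT := sub_pos.mpr (hdec.iInf_lt hbdd ((ℓ 0 - ⨅ y, ℓ y) / (ℓ 0 - ℓ 1)))
  -- Half of the left side in `not_relaxed_optimal`, to absorb its factor 2.
  have hε := half_pos (mul_pos (pow_pos hc 2) hT)
  obtain ⟨b, hb, hbB⟩ := exists_forall_ge_loss_mul_sq_lt hdec one_pos hε
  refine ⟨b, hb, fun B hB k φ hopt => ?_⟩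
  have hconst : ¬ M.InvariantPartConstant := by
    rintro ⟨r₀, hr₀⟩
    have h1 : ∀ᵐ r ∂M.invLaw, r = r₀ :=
      ae_invLaw_mem (measurableSet_singleton r₀) hr₀
    have h2 : M.invLaw {r₀} ≠ 0 := by
      rw [(prob_compl_eq_zero_iff (measurableSet_singleton r₀)).mp h1]
      exact one_ne_zero
    refine hpos (measure_mono_null (fun r hr => ?_) h1)
    intro h
    exact h2 (by rw [← h]; exact hr)
  obtain ⟨ψ, hψ, hφψ⟩ := hopt.exists_isInvRepresentation hconv hdec hbdd hrec hconst
  have h1 := not_relaxed_optimal hconv hdec (fun x => ciInf_le hbdd x) M.invLaw (hb.le.trans hB)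
    hψ.measurable hψ.norm_eq rfl hc fun w hw =>
      hopt.invLoss_le_relaxedLoss hℓ hdec hbdd hrec hK (hb.le.trans hB) hψ hφψ
        (measurableSet_setOf_measure_singleton_eq_zero _) hw
  have h2 := hbB B hB
  rw [one_mul] at h2
  linarith

end DataModel

/-! ### The theorem -/

theorem theorem2 (ℓ : ℝ → ℝ) (hconv : ConvexOn ℝ Set.univ ℓ) (hdec : StrictAnti ℓ)
    (hbdd : BddBelow (Set.range ℓ)) :
    -- (1) optimal representations do not depend on the spurious features
    (∀ (d : ℕ) (X : Type u) (M : DataModel d X), M.Recoverable → ¬ M.InvariantPartConstant →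
      ∀ (K : Set ℕ) (B : ℝ), 0 < B → ∀ (k : ℕ) (φ : X → Euc k), M.IsOptimal ℓ K B φ →
        IndependentOf M.D M.Rᶜ (fun z => φ (M.g z))) ∧
    -- (2) every invariant feature is encoded once the norm is large enough
    (∀ (d : ℕ) (X : Type u) (M : DataModel d X), M.Recoverable →
      ∀ K : Set ℕ, ¬ BddAbove K → ∀ i ∈ M.R, ∃ Bi : ℝ, 0 < Bi ∧
        ∀ B : ℝ, Bi ≤ B → ∀ (k : ℕ) (φ : X → Euc k), M.IsOptimal ℓ K B φ → M.Encodes φ i) ∧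
    -- (2, discrete case) the threshold is a decreasing function of the spread of the feature
    (∃ β : ℝ → ℝ, StrictAntiOn β (Set.Ioc 0 1) ∧ (∀ p ∈ Set.Ioc (0 : ℝ) 1, 0 < β p) ∧
      ∀ (d : ℕ) (X : Type u) (M : DataModel d X), M.Recoverable →
        (∃ C : Set (M.R → ℝ), C.Countable ∧ ∀ᵐ z ∂M.D, coords M.R z ∈ C) →
        ∀ K : Set ℕ, ¬ BddAbove K → ∀ i ∈ M.R, ∀ B : ℝ, 0 < B →
          (0 < M.spread i → β (M.spread i) ≤ B) →
          ∀ (k : ℕ) (φ : X → Euc k), M.IsOptimal ℓ K B φ → M.Encodes φ i) ∧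
    -- (2, finite case) the same with bounded or fixed output dimension, for `n` values of `z_R`
    (∀ n : ℕ, ∃ β : ℝ → ℝ, StrictAntiOn β (Set.Ioc 0 1) ∧ (∀ p ∈ Set.Ioc (0 : ℝ) 1, 0 < β p) ∧
      ∀ (d : ℕ) (X : Type u) (M : DataModel d X), M.Recoverable →
        (coords M.R '' M.Z).Finite → (coords M.R '' M.Z).ncard ≤ n →
        ∀ K : Set ℕ, (∃ k ∈ K, 2 ≤ k) → ∀ i ∈ M.R, ∀ B : ℝ, 0 < B →
          (0 < M.spread i → β (M.spread i) ≤ B) →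
          ∀ (k : ℕ) (φ : X → Euc k), M.IsOptimal ℓ K B φ → M.Encodes φ i) := by
  obtain ⟨β, hβanti, hβpos, hβ⟩ := exists_strictAntiOn_threshold hdec hbdd one_pos
  have hdiscrete : ∀ (d : ℕ) (X : Type u) (M : DataModel d X), M.Recoverable →
      (∃ C : Set (M.R → ℝ), C.Countable ∧ ∀ᵐ z ∂M.D, coords M.R z ∈ C) →
      ∀ K : Set ℕ, ¬ BddAbove K → ∀ i ∈ M.R, ∀ B : ℝ, 0 < B →
        (0 < M.spread i → β (M.spread i) ≤ B) →
        ∀ (k : ℕ) (φ : X → Euc k), M.IsOptimal ℓ K B φ → M.Encodes φ i := by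
    rintro d X M hrec ⟨C, hC, hCae⟩ K hK i hi B hB hβB k φ hopt hg hind
    have hpos : 0 < M.spread i := lt_of_le_of_ne measureReal_nonneg fun h =>
      hg (DataModel.independentOf_of_spread_eq_zero hC hCae hi h.symm M.g)
    have h1 := hopt.spread_mul_le hconv hdec hbdd hrec hK hB.le hi hpos hind
    have h2 := hβ _ hpos B (hβB hpos)
    rw [one_mul] at h2
    exact absurd h1 (not_le.mpr h2)
  refine ⟨?_, ?_, ⟨β, hβanti, hβpos, hdiscrete⟩, ?_⟩
  · intro d X M hrec hconst K B _ k φ hopt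
    obtain ⟨ψ, -, hφψ⟩ := hopt.exists_isInvRepresentation hconv hdec hbdd hrec hconst
    exact ⟨fun y => ψ fun j => y ⟨j, by simp⟩, hφψ⟩
  · intro d X M hrec K hK i hi
    -- Either `z_R` is almost surely one of countably many atoms, or no optimum of large norm exists
    -- and the claim is vacuous.
    by_cases hC : M.invLaw {r | M.invLaw {r} = 0} = 0
    · refine ⟨max 1 (β (M.spread i)), lt_max_of_lt_left one_pos, fun B hB =>
        hdiscrete d X M hrec
          ⟨_, countable_setOf_measure_singleton_ne_zero M.invLaw, ?_⟩ K hK i hi B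
          (one_pos.trans_le ((le_max_left _ _).trans hB)) fun _ => (le_max_right _ _).trans hB⟩
      exact DataModel.ae_coords_of_ae_invLaw (measure_eq_zero_iff_ae_notMem.mp hC)
    · obtain ⟨b, hb, hbB⟩ := DataModel.exists_forall_not_isOptimal hconv hdec hbdd hrec hK hC
      exact ⟨b, hb, fun B hB k φ hopt => absurd hopt (hbB B hB k φ)⟩
  · intro n
    obtain ⟨β', hβanti', hβpos', hβ'⟩ :=
      exists_strictAntiOn_threshold hdec hbdd (one_sub_cos_one_div_pos n)
    refine ⟨β', hβanti', hβpos', ?_⟩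
    rintro d X M hrec hfin hn K ⟨k', hk'K, hk'⟩ i hi B hB hβB k φ hopt hg hind
    have hpos : 0 < M.spread i := lt_of_le_of_ne measureReal_nonneg fun h =>
      hg (DataModel.independentOf_of_spread_eq_zero hfin.countable
        (M.mem_Z.mono fun z hz => ⟨z, hz, rfl⟩) hi h.symm M.g)
    have h1 := hopt.spread_mul_le_of_finite hconv hdec hbdd hrec hfin hn hk'K hk' hB.le hi hpos hind
    exact absurd h1 (not_le.mpr (hβ' _ hpos B (hβB hpos)))
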